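/- Definitions. For $n \ge 0$ let $\mathcal{Q}_n$ be the set of Stirling permutations of order $n$: the rearrangements $\sigma$ of the multiset $\{1^2, 2^2, \ldots, n^2\}$ such that, for each $i$, every letter between the two occurrences of $i$ is greater than $i$. The block $[i,i]_\sigma$ is the string of consecutive letters of $\sigma$ from the first to the second occurrence of $i$, both included. A block has level $1$ if it is contained in no other block; for $\ell \ge 2$, a block $[i,i]_\sigma$ has level $\ell$ if it is properly contained in a block $[j,j]_\sigma$ of level $\ell - 1$ (its parent) and is a level $1$ block of the string strictly between the two occurrences of $j$. Two blocks are siblings if both have level $1$ or they have the same parent. Let $\mathrm{bl}^{(\ell)}(\sigma)$ be the number of blocks of level $\ell$ of $\sigma$. A pattern is a permutation $p \in \mathfrak{S}_m$, $m \ge 1$, some of whose consecutive entries may be connected by underlines; the empty pattern $\emptyset$ is also allowed, with the convention that it never occurs. An occurrence of $p$ in a permutation $\pi \in \mathfrak{S}_n$ is a choice of positions $i_1 < \cdots < i_m$ such that $\pi_{i_1} \cdots \pi_{i_m}$ is order isomorphic to $p$, and $i_{j+1} = i_j + 1$ whenever $p_j$ and $p_{j+1}$ are connected by an underline; $p(\pi)$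 is the number of occurrences. An occurrence of $p$ as a block pattern at level $\ell$ in $\sigma \in \mathcal{Q}_n$ is a choice of level $\ell$ blocks $[b_1,b_1]_\sigma, \ldots, [b_m,b_m]_\sigma$, appearing from left to right in $\sigma$ and all siblings, such that $b_1 \cdots b_m$ is order isomorphic to $p$, and such that the second occurrence of $b_j$ is immediately followed by the first occurrence of $b_{j+1}$ in $\sigma$ whenever $p_j$ and $p_{j+1}$ are connected by an underline; $p^{(\ell)}(\sigma)$ is the number of such occurrences. For a set $A$ of patterns, let $\mathfrak{S}_n(A)$ be the set of $\pi \in \mathfrak{S}_n$ with $a(\pi) = 0$ for all $a \in A$, and for a pattern $p$ put $$F^{A,p}(t,z) = 1 + \sum_{n \ge 1} \frac{t^n}{n!} \sum_{\pi \in \mathfrak{S}_n(A)} z^{p(\pi)}.$$ For a sequence $\mathbf{A} = (A_1, A_2, \ldots)$ of sets of patterns, let $\mathcal{Q}_n(\mathbf{A})$ be the set of $\sigma \in \mathcal{Q}_n$ with $a^{(i)}(\sigma) = 0$ for all $i \ge 1$ and $a \in A_i$. For a sequence $\mathbf{p} = (p_1, p_2, \ldots)$ of patterns and sequences $\mathbf{x}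 = (x_1, x_2, \ldots)$, $\mathbf{y} = (y_1, y_2, \ldots)$ of elements of a commutative $\mathbb{Q}$-algebra $R$ (for instance, of indeterminates), put $$G^{\mathbf{A},\mathbf{p}}(t;\mathbf{x};\mathbf{y}) = 1 + \sum_{n \ge 1} \frac{t^n}{n!} \sum_{\sigma \in \mathcal{Q}_n(\mathbf{A})} \prod_{i \ge 1} x_i^{p_i^{(i)}(\sigma)} y_i^{\mathrm{bl}^{(i)}(\sigma)},$$ a formal power series in $t$ over $R$. For a sequence $\mathbf{s} = (s_1, s_2, s_3, \ldots)$ let $\mathrm{sh}(\mathbf{s}) = (s_2, s_3, \ldots)$. Theorem 1. For all $\mathbf{A}$, $\mathbf{p}$, $\mathbf{x}$ and $\mathbf{y}$ as above, the following identity of formal power series in $t$ holds: $$G^{\mathbf{A},\mathbf{p}}(t;\mathbf{x};\mathbf{y}) = F^{A_1,p_1}\left( y_1 \int_0^t G^{\mathrm{sh}(\mathbf{A}),\mathrm{sh}(\mathbf{p})}(u;\mathrm{sh}(\mathbf{x});\mathrm{sh}(\mathbf{y}))\,\mathrm{d}u,\; x_1 \right).$$ -/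

import Mathlib

open PowerSeries

noncomputable section

namespace BlockPattern

/-! ### Permutation patterns -/

/-- A permutation pattern: a permutation of length `len`, some of whose consecutive entries are
connected by an underline. An index `j` lies in `underline` when the entries at the positions
`j` and `j + 1` (counted from `0`) are connected. The pattern with `len = 0` is the empty pattern
`∅`; by convention it never occurs. -/
structure Pattern where
  len : ℕ
  perm : Equiv.Perm (Fin len)
  underline : Finset (Fin (len - 1))

/-- The entries at positions `j` and `j + 1` of `p` exist and are connected by an underline. -/
def Pattern.Linked (p : Pattern) (j : ℕ) : Prop :=
  ∃ h : j < p.len - 1, (⟨j, h⟩ : Fin (p.len - 1)) ∈ p.underline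

/-- The word `b` is order isomorphic to the permutation underlying `p`. -/
def Pattern.OrderIso (p : Pattern) {α : Type*} [LT α] (b : Fin p.len → α) : Prop :=
  ∀ j k, b j < b k ↔ p.perm j < p.perm k

/-- The positions `i` form an occurrence of `p` in the word `w` of length `n`. -/
def Pattern.IsOccurrence (p : Pattern) {n : ℕ} {α : Type*} [LT α] (w : Fin n → α)
    (i : Fin p.len → Fin n) : Prop :=
  0 < p.len ∧ StrictMono i ∧ p.OrderIso (fun j => w (i j)) ∧
    ∀ j k : Fin p.len, (k : ℕ) = j + 1 → p.Linked j → (i k : ℕ) = i j + 1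

/-- The number `p(π)` of occurrences of `p` in the permutation `π`. -/
def Pattern.count (p : Pattern) {n : ℕ} (π : Equiv.Perm (Fin n)) : ℕ :=
  {i : Fin p.len → Fin n | p.IsOccurrence π i}.ncard

open Classical in
/-- The set `𝔖_n(A)` of permutations of length `n` that avoid all the patterns in `A`. -/
def permAvoid (A : Set Pattern) (n : ℕ) : Finset (Equiv.Perm (Fin n)) :=
  {π | ∀ a ∈ A, a.count π = 0}

/-! ### Stirling permutations and blocks -/

/-- The string `(i,i)_w` of letters of `w` strictly between the first two occurrences of `i`. -/
def inner (w : List ℕ) (i : ℕ) : List ℕ :=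
  ((w.dropWhile (· != i)).tail).takeWhile (· != i)

/-- The string `[i,i]_w` (for a letter `i` that occurs exactly twice in `w`). -/
def block (w : List ℕ) (i : ℕ) : List ℕ :=
  i :: (inner w i ++ [i])

/-- The set `𝒬_n` of Stirling permutations of order `n`: the rearrangements of the multiset
`{1^2, …, n^2}` in which every letter between the two occurrences of `i` is greater than `i`. -/
def stirling (n : ℕ) : Finset (List ℕ) :=
  {w ∈ (Multiset.lists (2 • (Finset.Icc 1 n).val)).toFinset |
    ∀ i ∈ Finset.Icc 1 n, ∀ x ∈ inner w i, i < x}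

/-- `[i,i]_w ⊂ [j,j]_w`. -/
def Sub (w : List ℕ) (i j : ℕ) : Prop :=
  i ≠ j ∧ block w i <:+: block w j

/-- `[i,i]_w` is a level `1` block of the word `w`. -/
def IsLevelOne (w : List ℕ) (i : ℕ) : Prop :=
  i ∈ w ∧ ¬ ∃ j ∈ w, Sub w i j

/-- `[i,i]_w` is a level `ℓ` block of `w` (levels start at `1`). Passing to reduced forms does not
affect being a level `1` block, so the words `(j,j)_w` are not reduced. -/
def IsLevel (w : List ℕ) : ℕ → ℕ → Prop
  | 0, _ => False
  | 1, i => IsLevelOne w i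
  | ℓ + 2, i => ∃ j, IsLevel w (ℓ + 1) j ∧ Sub w i j ∧ IsLevelOne (inner w j) i

/-- `[j,j]_w` is the parent of the block `[i,i]_w`. -/
def IsParent (w : List ℕ) (j i : ℕ) : Prop :=
  ∃ ℓ, IsLevel w ℓ j ∧ IsLevel w (ℓ + 1) i ∧ Sub w i j

/-- The blocks `[i,i]_w` and `[j,j]_w` are siblings. -/
def Siblings (w : List ℕ) (i j : ℕ) : Prop :=
  (IsLevel w 1 i ∧ IsLevel w 1 j) ∨ ∃ k, IsParent w k i ∧ IsParent w k j

/-- The number `bl^{(ℓ)}(w)` of level `ℓ` blocks of `w`. -/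
def bl (ℓ : ℕ) (w : List ℕ) : ℕ :=
  {i : ℕ | IsLevel w ℓ i}.ncard

/-- The position in `w` of the first occurrence of `i`. -/
def firstPos (w : List ℕ) (i : ℕ) : ℕ :=
  w.idxOf i

/-- The position in `w` of the second occurrence of `i`. -/
def secondPos (w : List ℕ) (i : ℕ) : ℕ :=
  w.idxOf i + (inner w i).length + 1

/-- The blocks `[b_1,b_1]_w, …, [b_m,b_m]_w` form an occurrence of `p` as a block pattern in `w`
at level `ℓ`. -/
def Pattern.IsBlockOccurrence (p : Pattern) (ℓ : ℕ) (w : List ℕ) (b : Fin p.len → ℕ) : Prop :=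
  0 < p.len ∧ (∀ j, IsLevel w ℓ (b j)) ∧ StrictMono (fun j => firstPos w (b j)) ∧
    (∀ j k, Siblings w (b j) (b k)) ∧ p.OrderIso b ∧
    ∀ j k : Fin p.len, (k : ℕ) = j + 1 → p.Linked j → firstPos w (b k) = secondPos w (b j) + 1

/-- The number `p^{(ℓ)}(w)` of occurrences of `p` as a block pattern in `w` at level `ℓ`. -/
def Pattern.blockCount (p : Pattern) (ℓ : ℕ) (w : List ℕ) : ℕ :=
  {b : Fin p.len → ℕ | p.IsBlockOccurrence ℓ w b}.ncard

/-! ### Generating functions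

A sequence `(s_1, s_2, …)` is a function `s` on `ℕ` with `s i` the entry `s_{i+1}`. -/

/-- The shifted sequence `sh(s) = (s_2, s_3, …)`. -/
def sh {α : Type*} (s : ℕ → α) : ℕ → α :=
  fun i => s (i + 1)

open Classical in
/-- The set `𝒬_n(A)` of Stirling permutations that avoid all the patterns in `A_i` at level `i`,
for all `i ≥ 1`. -/
def stirlingAvoid (A : ℕ → Set Pattern) (n : ℕ) : Finset (List ℕ) :=
  {w ∈ stirling n | ∀ i, ∀ a ∈ A i, a.blockCount (i + 1) w = 0}

variable {R : Type*} [CommRing R] [Algebra ℚ R]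

/-- The exponential generating function `1 + ∑_{n ≥ 1} c_n t^n / n!`. -/
def egf (c : ℕ → R) : R⟦X⟧ :=
  PowerSeries.mk fun n => if n = 0 then 1 else algebraMap ℚ R (1 / (n.factorial : ℚ)) * c n

/-- The polynomial `f_n^{A,p}(z) = ∑ z^{p(π)}`, over `π ∈ 𝔖_n(A)`. -/
def f (A : Set Pattern) (p : Pattern) (n : ℕ) (z : R) : R :=
  ∑ π ∈ permAvoid A n, z ^ p.count π

/-- `F^{A,p}(t, z)`, as a formal power series in `t`. -/
def F (A : Set Pattern) (p : Pattern) (z : R) : R⟦X⟧ :=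
  egf fun n => f A p n z

/-- The polynomial `g_n^{A,p}(x; y)`. The product has only finitely many factors other than `1`, as
a Stirling permutation has blocks at finitely many levels only. -/
def g (A : ℕ → Set Pattern) (p : ℕ → Pattern) (n : ℕ) (x y : ℕ → R) : R :=
  ∑ w ∈ stirlingAvoid A n,
    ∏ᶠ i : ℕ, x i ^ (p i).blockCount (i + 1) w * y i ^ bl (i + 1) w

/-- `G^{A,p}(t; x; y)`, as a formal power series in `t`. -/
def G (A : ℕ → Set Pattern) (p : ℕ → Pattern) (x y : ℕ → R) : R⟦X⟧ :=
  egf fun n => g A p n x y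

/-- The formal integral `∫_0^t c(u) du`. -/
def integral (c : R⟦X⟧) : R⟦X⟧ :=
  PowerSeries.mk fun n => if n = 0 then 0 else algebraMap ℚ R (1 / (n : ℚ)) * coeff (n - 1) c

/-- Multiples of a formal integral can be substituted into a power series. -/
theorem hasSubst_C_mul_integral (a : R) (c : R⟦X⟧) :
    PowerSeries.HasSubst (PowerSeries.C a * integral c : R⟦X⟧) := by
  apply PowerSeries.HasSubst.of_constantCoeff_zero'
  simp [integral, ← PowerSeries.coeff_zero_eq_constantCoeff_apply]

end BlockPattern

end

noncomputable section

namespace BlockPattern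

/-! A Stirling word is a concatenation of level 1 blocks `b l b`. It amounts to the word `s` of its
level 1 letters together with, for each `b` in `s`, an inner Stirling word on a set `T_b` of letters
greater than `b`. Level 1 patterns see only `s` (`IsNested.blockCount_one`). Since the blocks of an
occurrence are siblings, an occurrence at a deeper level lies inside a single inner word, one level
up (`IsSplit.blockCount_add_two`). So the weight factors (`weight_eq_mul`), and summing the deep
factor over all words with given `s` yields `fillSum` (`sum_deepWeight`).

Two facts decouple `s` from its filling. The condition on `T_b` does not involve the place of `b` in
`s`, so `fillSum` depends only on the set `M` of letters of `s` (`fillSum_perm`), while the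
orderings of `M` contribute `f` at `M.card` (`sum_topWeight`). Moreover the least letter is always
at level 1. Removing it with its set gives the recurrence behind `(H^m / m!)' = H' * H^(m-1) /
(m-1)!`, where `H` is `y 0` times the integral of the shifted `G` (`sum_fillSum`,
`factorial_mul_coeff_pow`). The total is therefore the sum of `f_m * H^m / m!`, which is `F` at `H`.

Inner words have fewer letters than the whole, so a strong induction shows that sums over Stirling
words depend only on the number of letters (`sum_weight_eq`). -/

/-! ### Decomposition of Stirling words -/

/-- The word `b l b r`, whose first level `1` block is `b l b`. -/
abbrev blockCons (b : ℕ) (l r : List ℕ) : List ℕ :=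
  b :: (l ++ b :: r)

theorem exists_eq_append_of_two_le_count {i : ℕ} {w : List ℕ} (h : 2 ≤ w.count i) :
    ∃ u v z, w = u ++ i :: (v ++ i :: z) ∧ i ∉ u ∧ i ∉ v := by
  obtain ⟨u, z, rfl, hu⟩ := List.eq_append_cons_of_mem (List.count_pos_iff.1 (by omega : 0 < w.count i))
  have hz : 0 < z.count i := by
    simp [List.count_eq_zero_of_not_mem hu] at h
    simpa using h
  obtain ⟨v, z, rfl, hv⟩ := List.eq_append_cons_of_mem (List.count_pos_iff.1 hz)
  exact ⟨u, v, z, rfl, hu, hv⟩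

theorem inner_append_eq {u v z : List ℕ} {i : ℕ} (hu : i ∉ u) (hv : i ∉ v) :
    inner (u ++ i :: (v ++ i :: z)) i = v := by
  have h : ∀ l : List ℕ, i ∉ l → ∀ a ∈ l, (a != i) = true := by
    intro l hl a ha
    simp only [bne_iff_ne]
    rintro rfl
    exact hl ha
  rw [inner, List.dropWhile_append_of_pos (h u hu), List.dropWhile_cons_of_neg (by simp),
    List.tail_cons, List.takeWhile_append_of_pos (h v hv), List.takeWhile_cons_of_neg (by simp),
    List.append_nil]

theorem mem_of_mem_inner {w : List ℕ} {i x : ℕ} (h : x ∈ inner w i) : x ∈ w :=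
  (List.dropWhile_sublist _).subset (List.mem_of_mem_tail ((List.takeWhile_sublist _).subset h))

theorem mem_of_mem_block {w : List ℕ} {i x : ℕ} (hi : i ∈ w) (h : x ∈ block w i) : x ∈ w := by
  simp only [block, List.mem_cons, List.mem_append, List.not_mem_nil, or_false] at h
  rcases h with rfl | h | rfl
  · exact hi
  · exact mem_of_mem_inner h
  · exact hi

theorem self_mem_block (w : List ℕ) (i : ℕ) : i ∈ block w i := List.mem_cons_self

theorem block_infix {w : List ℕ} {i : ℕ} (h : 2 ≤ w.count i) : block w i <:+: w := by
  obtain ⟨u, v, z, rfl, hu, hv⟩ := exists_eq_append_of_two_le_count h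
  rw [block, inner_append_eq hu hv]
  exact ⟨u, z, by simp⟩

theorem inner_blockCons_self {b : ℕ} {l r : List ℕ} (h : b ∉ l) :
    inner (blockCons b l r) b = l := by
  simpa using inner_append_eq (u := []) (z := r) (List.not_mem_nil) h

theorem inner_blockCons_left {b i : ℕ} {l r : List ℕ} (hb : i ≠ b) (h : 2 ≤ l.count i) :
    inner (blockCons b l r) i = inner l i := by
  obtain ⟨u, v, z, rfl, hu, hv⟩ := exists_eq_append_of_two_le_count h
  rw [inner_append_eq hu hv]
  have := inner_append_eq (u := b :: u) (v := v) (z := z ++ b :: r) (i := i)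
    (by simp [hb, hu]) hv
  simpa [blockCons] using this

theorem inner_blockCons_right {b i : ℕ} {l r : List ℕ} (hb : i ≠ b) (h : i ∉ l) :
    inner (blockCons b l r) i = inner r i := by
  have h' : ∀ a ∈ b :: (l ++ [b]), (a != i) = true := by
    intro a ha
    simp only [bne_iff_ne]
    rintro rfl
    simp [hb, h] at ha
  have : blockCons b l r = (b :: (l ++ [b])) ++ r := by simp
  rw [inner, this, List.dropWhile_append_of_pos h', inner]

/-- Words in which every letter occurs exactly twice, with only greater letters in between. -/
inductive IsNested : List ℕ → Prop
  | nil : IsNested []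
  | blockCons {b : ℕ} {l r : List ℕ} (hl : IsNested l) (hr : IsNested r) (hbr : b ∉ r)
      (hlr : List.Disjoint l r) (hlt : ∀ x ∈ l, b < x) : IsNested (blockCons b l r)

theorem IsNested.count_eq {w : List ℕ} (h : IsNested w) {i : ℕ} (hi : i ∈ w) : w.count i = 2 := by
  induction h with
  | nil => simp at hi
  | @blockCons b l r hl hr hbr hlr hlt ihl ihr =>
    have hbl : b ∉ l := fun h => lt_irrefl _ (hlt b h)
    by_cases hb : i = b
    · subst hb
      simp [List.count_eq_zero_of_not_mem hbl, List.count_eq_zero_of_not_mem hbr]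
    · have hb' : b ≠ i := Ne.symm hb
      by_cases hil : i ∈ l
      · have := List.count_eq_zero_of_not_mem (hlr hil)
        simp [List.count_cons_of_ne hb', ihl hil, this]
      · have hir : i ∈ r := by simpa [hb, hil] using hi
        simp [List.count_cons_of_ne hb', ihr hir, List.count_eq_zero_of_not_mem hil]

theorem IsNested.lt_of_mem_inner {w : List ℕ} (h : IsNested w) {i x : ℕ} (hi : i ∈ w)
    (hx : x ∈ inner w i) : i < x := by
  induction h with
  | nil => simp at hi
  | @blockCons b l r hl hr hbr hlr hlt ihl ihr =>
    have hbl : b ∉ l := fun h => lt_irrefl _ (hlt b h)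
    by_cases hb : i = b
    · subst hb
      rw [inner_blockCons_self hbl] at hx
      exact hlt x hx
    · by_cases hil : i ∈ l
      · rw [inner_blockCons_left hb (hl.count_eq hil).ge] at hx
        exact ihl hil hx
      · rw [inner_blockCons_right hb hil] at hx
        exact ihr (by simpa [hb, hil] using hi) hx

/-- Cut at the two occurrences of the first letter `b`, so that `w = b l b r`. A letter common to
`l` and `r` would enclose the second `b` and so be smaller than `b`, though letters of `l` are
greater. Hence `l` and `r` share no letter and the argument recurses. -/
theorem isNested_of_count_eq (w : List ℕ) (hc : ∀ i ∈ w, w.count i = 2)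
    (hlt : ∀ i ∈ w, ∀ x ∈ inner w i, i < x) : IsNested w := by
  induction hn : w.length using Nat.strong_induction_on generalizing w with
  | _ n ih =>
  rcases w with _ | ⟨b, w⟩
  · exact .nil
  have hbw : w.count b = 1 := by simpa using hc b List.mem_cons_self
  obtain ⟨l, r, rfl, hbl⟩ := List.eq_append_cons_of_mem
    (List.count_pos_iff.1 (by omega : 0 < w.count b))
  have hbr : b ∉ r := by
    simpa [List.count_eq_zero_of_not_mem hbl, List.count_eq_zero] using hbw
  have hltl : ∀ x ∈ l, b < x := fun x hx =>
    hlt b List.mem_cons_self x (by rwa [inner_blockCons_self hbl])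
  have hne : ∀ {x}, x ∈ l → b ≠ x := fun hx => (hltl _ hx).ne
  have hsum : ∀ x, x ≠ b → x ∈ l ∨ x ∈ r → l.count x + r.count x = 2 := by
    intro x hxb hx
    have := hc x (by simp; tauto)
    simpa [List.count_cons_of_ne hxb.symm] using this
  have hlr : List.Disjoint l r := by
    intro x hxl hxr
    have h1 := List.count_pos_iff.2 hxl
    have h2 := List.count_pos_iff.2 hxr
    have h3 := hsum x (hne hxl).symm (.inl hxl)
    obtain ⟨l₁, l₂, rfl, hl₁⟩ := List.eq_append_cons_of_mem hxl
    obtain ⟨r₁, r₂, rfl, hr₁⟩ := List.eq_append_cons_of_mem hxr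
    have hl₂ : x ∉ l₂ := by
      rw [← List.count_eq_zero]
      simp at h1 h2 h3
      omega
    have hin : inner (b :: ((l₁ ++ x :: l₂) ++ b :: (r₁ ++ x :: r₂))) x = l₂ ++ b :: r₁ := by
      have := inner_append_eq (u := b :: l₁) (v := l₂ ++ b :: r₁) (z := r₂) (i := x)
        (by simp [(hne hxl).symm, hl₁]) (by simp [(hne hxl).symm, hl₂, hr₁])
      simpa using this
    have := hlt x (by simp) b (by rw [hin]; simp)
    exact absurd (hltl x hxl) this.not_gt
  have hcl : ∀ i ∈ l, l.count i = 2 := fun i hi => by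
    have := hsum i (hne hi).symm (.inl hi)
    rwa [List.count_eq_zero_of_not_mem (hlr hi), add_zero] at this
  have hcr : ∀ i ∈ r, r.count i = 2 := fun i hi => by
    have := hsum i (by rintro rfl; exact hbr hi) (.inr hi)
    rwa [List.count_eq_zero_of_not_mem (fun h => hlr h hi), zero_add] at this
  simp only [List.length_cons, List.length_append] at hn
  refine .blockCons (ih l.length (by omega) l hcl ?_ rfl) (ih r.length (by omega) r hcr ?_ rfl)
    hbr hlr hltl
  · intro i hi x hx
    refine hlt i (by simp [hi]) x ?_
    rwa [inner_blockCons_left (hne hi).symm (hcl i hi).ge]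
  · intro i hi x hx
    refine hlt i (by simp [hi]) x ?_
    rwa [inner_blockCons_right (by rintro rfl; exact hbr hi) (fun h => hlr h hi)]

/-- The Stirling words on the set of letters `S`. -/
def stirlingOn (S : Finset ℕ) : Finset (List ℕ) :=
  {w ∈ (Multiset.lists (2 • S.val)).toFinset | ∀ i ∈ S, ∀ x ∈ inner w i, i < x}

theorem mem_stirlingOn {S : Finset ℕ} {w : List ℕ} :
    w ∈ stirlingOn S ↔ IsNested w ∧ w.toFinset = S := by
  have key : (2 • S.val = (w : Multiset ℕ)) ↔ ∀ i, w.count i = if i ∈ S then 2 else 0 := by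
    rw [Multiset.ext]
    refine forall_congr' fun i => ?_
    rw [Multiset.count_nsmul, Multiset.coe_count, Multiset.count_eq_of_nodup S.nodup]
    simp only [Finset.mem_val]
    split_ifs <;> omega
  rw [stirlingOn, Finset.mem_filter, Multiset.mem_toFinset, Multiset.mem_lists_iff]
  change (2 • S.val = (w : Multiset ℕ)) ∧ _ ↔ _
  rw [key]
  constructor
  · rintro ⟨hc, hlt⟩
    have hS : ∀ i, i ∈ w ↔ i ∈ S := by
      intro i
      rw [← List.count_pos_iff, hc]
      split_ifs with h <;> simp [h]
    exact ⟨isNested_of_count_eq w (fun i hi => by simp [hc, (hS i).1 hi])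
      (fun i hi => hlt i ((hS i).1 hi)), by ext i; simp [hS]⟩
  · rintro ⟨hw, rfl⟩
    refine ⟨fun i => ?_, fun i hi x hx => hw.lt_of_mem_inner (by simpa using hi) hx⟩
    split_ifs with h
    · exact hw.count_eq (by simpa using h)
    · exact List.count_eq_zero_of_not_mem (by simpa using h)

theorem stirlingOn_empty : stirlingOn ∅ = {[]} := by
  ext w
  rw [mem_stirlingOn, Finset.mem_singleton, List.toFinset_eq_empty_iff]
  exact ⟨fun h => h.2, by rintro rfl; exact ⟨.nil, rfl⟩⟩

/-- Summation over nonempty Stirling words by splitting off the first level `1` block. -/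
theorem sum_stirlingOn {M : Type*} [AddCommMonoid M] {S : Finset ℕ} (hS : S.Nonempty)
    (Φ : List ℕ → M) :
    ∑ w ∈ stirlingOn S, Φ w = ∑ b ∈ S, ∑ T ∈ S.powerset with ∀ x ∈ T, b < x,
      ∑ l ∈ stirlingOn T, ∑ r ∈ stirlingOn (S.erase b \ T), Φ (blockCons b l r) := by
  simp only [Finset.sum_sigma']
  symm
  refine Finset.sum_bij (fun q _ => blockCons q.1 q.2.2.1 q.2.2.2) ?_ ?_ ?_ (fun _ _ => rfl)
  · rintro ⟨b, T, l, r⟩ h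
    simp only [Finset.mem_sigma, Finset.mem_filter, Finset.mem_powerset, mem_stirlingOn] at h ⊢
    obtain ⟨hb, ⟨hTS, hbT⟩, ⟨hl, rfl⟩, hr, hr'⟩ := h
    have hr'' : ∀ x, x ∈ r ↔ (x ≠ b ∧ x ∈ S) ∧ x ∉ l := by
      intro x
      rw [← List.mem_toFinset, hr']
      simp
    refine ⟨.blockCons hl hr (by simp [hr'']) (fun x hx => by simp [hr'', hx])
      (by simpa using hbT), ?_⟩
    ext x
    have : x ∈ l → x ∈ S := fun h => hTS (by simpa using h)
    have : x = b → x ∈ S := by rintro rfl; exact hb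
    simp [hr'']
    tauto
  · rintro ⟨b, T, l, r⟩ h ⟨b', T', l', r'⟩ h' heq
    simp only [Finset.mem_sigma, Finset.mem_filter, Finset.mem_powerset, mem_stirlingOn] at h h'
    obtain ⟨hb, ⟨hTS, hbT⟩, ⟨hl, rfl⟩, hr, hr'⟩ := h
    obtain ⟨hb', ⟨hTS', hbT'⟩, ⟨hl', rfl⟩, hrr, hrr'⟩ := h'
    simp only [List.cons.injEq] at heq
    obtain ⟨rfl, heq⟩ := heq
    have h1 : b ∉ l := fun h => lt_irrefl _ (hbT b (by simpa using h))
    have h2 : b ∉ r := by rw [← List.mem_toFinset, hr']; simp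
    have h3 : b ∉ l' := fun h => lt_irrefl _ (hbT' b (by simpa using h))
    have h4 : b ∉ r' := by rw [← List.mem_toFinset, hrr']; simp
    -- The letter `b` occurs in neither `l` nor `r`, so it marks the only possible cut.
    obtain ⟨rfl, -, rfl⟩ := (List.append_cons_inj_of_notMem h1 h2).1 heq
    rfl
  · intro w hw
    obtain ⟨hw', rfl⟩ := mem_stirlingOn.1 hw
    cases hw' with
    | nil => simp at hS
    | @blockCons b l r hl hr hbr hlr hlt =>
      refine ⟨⟨b, l.toFinset, l, r⟩, ?_, rfl⟩
      simp only [Finset.mem_sigma, Finset.mem_filter, Finset.mem_powerset, mem_stirlingOn]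
      refine ⟨by simp, ⟨?_, by simpa using hlt⟩, ⟨hl, trivial⟩, hr, ?_⟩
      · intro x hx
        simp at hx
        simp [hx]
      · ext x
        have h1 : x ∈ r → x ∉ l := fun h h' => hlr h' h
        have h2 : x = b → x ∉ r := by rintro rfl; exact hbr
        simp
        tauto

/-! ### Levels of blocks -/

theorem IsLevelOne.mem {w : List ℕ} {i : ℕ} (h : IsLevelOne w i) : i ∈ w := h.1

theorem IsLevel.mem {w : List ℕ} {ℓ i : ℕ} (h : IsLevel w ℓ i) : i ∈ w := by
  match ℓ, h with
  | 1, h => exact h.1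
  | ℓ + 2, ⟨j, _, _, h⟩ => exact mem_of_mem_inner h.1

theorem not_isLevel_zero {w : List ℕ} {i : ℕ} : ¬ IsLevel w 0 i := id

theorem IsParent.mem_left {w : List ℕ} {i j : ℕ} (hp : IsParent w j i) :
    j ∈ w := by
  obtain ⟨ℓ, hj, -, -⟩ := hp
  exact hj.mem

theorem finite_setOf_isLevel (w : List ℕ) (ℓ : ℕ) :
    {i | IsLevel w ℓ i}.Finite :=
  w.toFinset.finite_toSet.subset fun i hi => by simpa using IsLevel.mem hi

theorem finite_setOf_isBlockOccurrence (p : Pattern) (ℓ : ℕ) (w : List ℕ) :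
    {c | p.IsBlockOccurrence ℓ w c}.Finite :=
  (Set.Finite.pi' fun _ => finite_setOf_isLevel w ℓ).subset fun _ hc => hc.2.1

/-- The hypotheses under which `b l b r` is a Stirling word with first block `b l b`. -/
structure IsSplit (b : ℕ) (l r : List ℕ) : Prop where
  left : IsNested l
  right : IsNested r
  notMem_right : b ∉ r
  disjoint : List.Disjoint l r
  lt : ∀ x ∈ l, b < x

namespace IsSplit

variable {b : ℕ} {l r : List ℕ} (h : IsSplit b l r)
include h

theorem notMem_left : b ∉ l := fun hb => lt_irrefl _ (h.lt b hb)

theorem ne_of_mem_left {i : ℕ} (hi : i ∈ l) : i ≠ b := (h.lt i hi).ne'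

theorem ne_of_mem_right {i : ℕ} (hi : i ∈ r) : i ≠ b := by
  rintro rfl
  exact h.notMem_right hi

theorem notMem_left_of_mem_right {i : ℕ} (hi : i ∈ r) : i ∉ l := fun hl => h.disjoint hl hi

theorem inner_self : inner (blockCons b l r) b = l := inner_blockCons_self h.notMem_left

theorem inner_left {i : ℕ} (hi : i ∈ l) : inner (blockCons b l r) i = inner l i :=
  inner_blockCons_left (h.ne_of_mem_left hi) (h.left.count_eq hi).ge

theorem inner_right {i : ℕ} (hi : i ∈ r) : inner (blockCons b l r) i = inner r i :=
  inner_blockCons_right (h.ne_of_mem_right hi) (h.notMem_left_of_mem_right hi)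

theorem block_left {i : ℕ} (hi : i ∈ l) : block (blockCons b l r) i = block l i := by
  rw [block, block, h.inner_left hi]

theorem block_right {i : ℕ} (hi : i ∈ r) : block (blockCons b l r) i = block r i := by
  rw [block, block, h.inner_right hi]

theorem sub_left_iff {i j : ℕ} (hi : i ∈ l) (hj : j ∈ l) :
    Sub (blockCons b l r) i j ↔ Sub l i j := by
  rw [Sub, Sub, h.block_left hi, h.block_left hj]

theorem sub_right_iff {i j : ℕ} (hi : i ∈ r) (hj : j ∈ r) :
    Sub (blockCons b l r) i j ↔ Sub r i j := by
  rw [Sub, Sub, h.block_right hi, h.block_right hj]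

theorem sub_left_self {i : ℕ} (hi : i ∈ l) : Sub (blockCons b l r) i b := by
  refine ⟨h.ne_of_mem_left hi, ?_⟩
  rw [h.block_left hi]
  refine (block_infix (h.left.count_eq hi).ge).trans ?_
  rw [block, h.inner_self]
  exact ⟨[b], [b], by simp⟩

theorem mem_left_of_sub_left {i j : ℕ} (hj : j ∈ l) (hs : Sub (blockCons b l r) i j) : i ∈ l := by
  refine mem_of_mem_block hj ?_
  rw [← h.block_left hj]
  exact hs.2.subset (self_mem_block _ _)

theorem mem_right_of_sub_right {i j : ℕ} (hj : j ∈ r) (hs : Sub (blockCons b l r) i j) :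
    i ∈ r := by
  refine mem_of_mem_block hj ?_
  rw [← h.block_right hj]
  exact hs.2.subset (self_mem_block _ _)

theorem mem_left_of_sub_self {i : ℕ} (hs : Sub (blockCons b l r) i b) : i ∈ l := by
  have := hs.2.subset (self_mem_block _ _)
  rw [block, h.inner_self] at this
  simpa [hs.1] using this

theorem isLevelOne_iff {i : ℕ} : IsLevelOne (blockCons b l r) i ↔ i = b ∨ IsLevelOne r i := by
  constructor
  · rintro ⟨hi, hn⟩
    simp only [List.mem_cons, List.mem_append] at hi
    rcases hi with rfl | hi | rfl | hi
    · exact .inl rfl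
    · exact absurd ⟨b, List.mem_cons_self, h.sub_left_self hi⟩ hn
    · exact .inl rfl
    · refine .inr ⟨hi, fun ⟨j, hj, hs⟩ => hn ⟨j, by simp [hj], (h.sub_right_iff hi hj).2 hs⟩⟩
  · rintro (rfl | ⟨hi, hn⟩)
    · refine ⟨List.mem_cons_self, fun ⟨j, hj, hs⟩ => ?_⟩
      simp only [List.mem_cons, List.mem_append] at hj
      rcases hj with rfl | hj | rfl | hj
      · exact hs.1 rfl
      · exact h.notMem_left (h.mem_left_of_sub_left hj hs)
      · exact hs.1 rfl
      · exact h.notMem_right (h.mem_right_of_sub_right hj hs)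
    · refine ⟨by simp [hi], fun ⟨j, hj, hs⟩ => ?_⟩
      simp only [List.mem_cons, List.mem_append] at hj
      rcases hj with rfl | hj | rfl | hj
      · exact h.notMem_left_of_mem_right hi (h.mem_left_of_sub_self hs)
      · exact h.notMem_left_of_mem_right hi (h.mem_left_of_sub_left hj hs)
      · exact h.notMem_left_of_mem_right hi (h.mem_left_of_sub_self hs)
      · exact hn ⟨j, hj, (h.sub_right_iff hi hj).1 hs⟩

theorem isLevel_one_iff {i : ℕ} : IsLevel (blockCons b l r) 1 i ↔ i = b ∨ IsLevel r 1 i :=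
  h.isLevelOne_iff

/-- Follow the chain of parents up to level 1: if it ends at `b`, the block sits in `l`, where one
level is lost; otherwise the whole chain lies in `r`. -/
theorem isLevel_add_two_iff {ℓ i : ℕ} :
    IsLevel (blockCons b l r) (ℓ + 2) i ↔ IsLevel l (ℓ + 1) i ∨ IsLevel r (ℓ + 2) i := by
  induction ℓ generalizing i with
  | zero =>
    constructor
    · rintro ⟨j, hj, hs, hi⟩
      rcases h.isLevel_one_iff.1 hj with rfl | hj
      · rw [h.inner_self] at hi
        exact .inl hi
      · have hi' := h.mem_right_of_sub_right hj.mem hs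
        rw [h.inner_right hj.mem] at hi
        exact .inr ⟨j, hj, (h.sub_right_iff hi' hj.mem).1 hs, hi⟩
    · rintro (hi | ⟨j, hj, hs, hi⟩)
      · exact ⟨b, h.isLevel_one_iff.2 (.inl rfl), h.sub_left_self hi.mem, by rwa [h.inner_self]⟩
      · exact ⟨j, h.isLevel_one_iff.2 (.inr hj),
          (h.sub_right_iff (mem_of_mem_inner hi.mem) hj.mem).2 hs, by rwa [h.inner_right hj.mem]⟩
  | succ ℓ ih =>
    constructor
    · rintro ⟨j, hj, hs, hi⟩
      rcases ih.1 hj with hj | hj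
      · have hi' := h.mem_left_of_sub_left hj.mem hs
        rw [h.inner_left hj.mem] at hi
        exact .inl ⟨j, hj, (h.sub_left_iff hi' hj.mem).1 hs, hi⟩
      · have hi' := h.mem_right_of_sub_right hj.mem hs
        rw [h.inner_right hj.mem] at hi
        exact .inr ⟨j, hj, (h.sub_right_iff hi' hj.mem).1 hs, hi⟩
    · rintro (⟨j, hj, hs, hi⟩ | ⟨j, hj, hs, hi⟩)
      · exact ⟨j, ih.2 (.inl hj),
          (h.sub_left_iff (mem_of_mem_inner hi.mem) hj.mem).2 hs, by rwa [h.inner_left hj.mem]⟩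
      · exact ⟨j, ih.2 (.inr hj),
          (h.sub_right_iff (mem_of_mem_inner hi.mem) hj.mem).2 hs, by rwa [h.inner_right hj.mem]⟩

theorem isLevel_right_iff {ℓ i : ℕ} (hi : i ∈ r) :
    IsLevel (blockCons b l r) ℓ i ↔ IsLevel r ℓ i := by
  rcases ℓ with _ | _ | ℓ
  · exact Iff.rfl
  · rw [zero_add, h.isLevel_one_iff, or_iff_right (h.ne_of_mem_right hi)]
  · rw [h.isLevel_add_two_iff, or_iff_right]
    exact fun hl => h.notMem_left_of_mem_right hi hl.mem

theorem isLevel_left_iff {ℓ i : ℕ} (hi : i ∈ l) :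
    IsLevel (blockCons b l r) (ℓ + 1) i ↔ IsLevel l ℓ i := by
  rcases ℓ with _ | ℓ
  · rw [zero_add, h.isLevel_one_iff, iff_false_right not_isLevel_zero]
    rintro (rfl | hr)
    · exact h.notMem_left hi
    · exact h.disjoint hi hr.mem
  · rw [h.isLevel_add_two_iff, or_iff_left]
    exact fun hr => h.disjoint hi hr.mem

theorem isLevel_self_iff {ℓ : ℕ} : IsLevel (blockCons b l r) ℓ b ↔ ℓ = 1 := by
  rcases ℓ with _ | _ | ℓ
  · simp [not_isLevel_zero]
  · simp [h.isLevel_one_iff]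
  · rw [h.isLevel_add_two_iff]
    refine iff_of_false ?_ (by omega)
    rintro (hl | hr)
    · exact h.notMem_left hl.mem
    · exact h.notMem_right hr.mem

theorem isParent_right_iff {i j : ℕ} (hi : i ∈ r) :
    IsParent (blockCons b l r) j i ↔ IsParent r j i := by
  constructor
  · rintro ⟨ℓ, hj, hil, hs⟩
    have hjr : j ∈ r := by
      have := hj.mem
      simp only [List.mem_cons, List.mem_append] at this
      rcases this with rfl | hj | rfl | hj
      · exact absurd (h.mem_left_of_sub_self hs) (h.notMem_left_of_mem_right hi)
      · exact absurd (h.mem_left_of_sub_left hj hs) (h.notMem_left_of_mem_right hi)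
      · exact absurd (h.mem_left_of_sub_self hs) (h.notMem_left_of_mem_right hi)
      · exact hj
    exact ⟨ℓ, (h.isLevel_right_iff hjr).1 hj, (h.isLevel_right_iff hi).1 hil,
      (h.sub_right_iff hi hjr).1 hs⟩
  · rintro ⟨ℓ, hj, hil, hs⟩
    exact ⟨ℓ, (h.isLevel_right_iff hj.mem).2 hj, (h.isLevel_right_iff hi).2 hil,
      (h.sub_right_iff hi hj.mem).2 hs⟩

theorem isParent_left_iff {i j : ℕ} (hi : i ∈ l) :
    IsParent (blockCons b l r) j i ↔ (j = b ∧ IsLevel l 1 i) ∨ IsParent l j i := by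
  constructor
  · rintro ⟨ℓ, hj, hil, hs⟩
    have := hj.mem
    have hb : j = b → (j = b ∧ IsLevel l 1 i) ∨ IsParent l j i := by
      rintro rfl
      rw [h.isLevel_self_iff] at hj
      subst hj
      exact .inl ⟨rfl, (h.isLevel_left_iff hi).1 hil⟩
    simp only [List.mem_cons, List.mem_append] at this
    rcases this with hjb | hjl | hjb | hjr
    · exact hb hjb
    · rcases ℓ with _ | ℓ
      · exact absurd hj not_isLevel_zero
      · exact .inr ⟨ℓ, (h.isLevel_left_iff hjl).1 hj, (h.isLevel_left_iff hi).1 hil,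
          (h.sub_left_iff hi hjl).1 hs⟩
    · exact hb hjb
    · exact absurd (h.mem_right_of_sub_right hjr hs) (h.disjoint hi)
  · rintro (⟨rfl, hi1⟩ | ⟨ℓ, hj, hil, hs⟩)
    · exact ⟨1, h.isLevel_self_iff.2 rfl, (h.isLevel_left_iff hi).2 hi1, h.sub_left_self hi⟩
    · exact ⟨ℓ + 1, (h.isLevel_left_iff hj.mem).2 hj, (h.isLevel_left_iff hi).2 hil,
        (h.sub_left_iff hi hj.mem).2 hs⟩

theorem siblings_right_iff {i j : ℕ} (hi : i ∈ r) (hj : j ∈ r) :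
    Siblings (blockCons b l r) i j ↔ Siblings r i j := by
  simp only [Siblings, h.isLevel_right_iff hi, h.isLevel_right_iff hj, h.isParent_right_iff hi,
    h.isParent_right_iff hj]

/-- Level 1 blocks of `l` have no parent in `l` but become children of `b`, so the first way of
being siblings in `l` turns into the second way in `b l b r`. -/
theorem siblings_left_iff {i j : ℕ} (hi : i ∈ l) (hj : j ∈ l) :
    Siblings (blockCons b l r) i j ↔ Siblings l i j := by
  have h0 : ∀ k, k ∈ l → ¬ IsLevel (blockCons b l r) 1 k := fun k hk hk' =>
    not_isLevel_zero ((h.isLevel_left_iff hk).1 hk')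
  simp only [Siblings, h0 i hi, false_and, false_or, h.isParent_left_iff hi,
    h.isParent_left_iff hj]
  have hb : ∀ k, ¬ IsParent l b k := fun k hk => h.notMem_left hk.mem_left
  constructor
  · rintro ⟨k, hk, hk'⟩
    by_cases hkb : k = b
    · subst hkb
      simp only [true_and, hb, or_false] at hk hk'
      exact .inl ⟨hk, hk'⟩
    · simp only [hkb, false_and, false_or] at hk hk'
      exact .inr ⟨k, hk, hk'⟩
  · rintro (⟨hi1, hj1⟩ | ⟨k, hk, hk'⟩)
    · exact ⟨b, .inl ⟨rfl, hi1⟩, .inl ⟨rfl, hj1⟩⟩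
    · exact ⟨k, .inr hk, .inr hk'⟩

theorem not_siblings {i j : ℕ} (hi : i ∈ l) (hj : j ∈ r) : ¬ Siblings (blockCons b l r) i j := by
  rintro (⟨hi1, -⟩ | ⟨k, hk, hk'⟩)
  · exact not_isLevel_zero ((h.isLevel_left_iff hi).1 hi1)
  · have hkr := ((h.isParent_right_iff hj).1 hk').mem_left
    rcases (h.isParent_left_iff hi).1 hk with ⟨rfl, -⟩ | hk
    · exact h.notMem_right hkr
    · exact h.disjoint hk.mem_left hkr

omit h in
theorem firstPos_self : firstPos (blockCons b l r) b = 0 := by simp [firstPos]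

theorem firstPos_left {i : ℕ} (hi : i ∈ l) : firstPos (blockCons b l r) i = firstPos l i + 1 := by
  simp [firstPos, List.idxOf_cons_ne _ (h.ne_of_mem_left hi).symm, List.idxOf_append_of_mem hi]

theorem firstPos_right {i : ℕ} (hi : i ∈ r) :
    firstPos (blockCons b l r) i = firstPos r i + (l.length + 2) := by
  simp [firstPos, List.idxOf_cons_ne _ (h.ne_of_mem_right hi).symm,
    List.idxOf_append_of_notMem (h.notMem_left_of_mem_right hi)]
  omega

theorem secondPos_self : secondPos (blockCons b l r) b = l.length + 1 := by
  simp [secondPos, h.inner_self]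

theorem secondPos_left {i : ℕ} (hi : i ∈ l) :
    secondPos (blockCons b l r) i = secondPos l i + 1 := by
  have := h.firstPos_left hi
  simp only [firstPos] at this
  rw [secondPos, secondPos, h.inner_left hi, this]
  omega

theorem secondPos_right {i : ℕ} (hi : i ∈ r) :
    secondPos (blockCons b l r) i = secondPos r i + (l.length + 2) := by
  have := h.firstPos_right hi
  simp only [firstPos] at this
  rw [secondPos, secondPos, h.inner_right hi, this]
  omega

theorem isBlockOccurrence_left_iff {p : Pattern} {ℓ : ℕ} {c : Fin p.len → ℕ} (hc : ∀ j, c j ∈ l) :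
    p.IsBlockOccurrence (ℓ + 1) (blockCons b l r) c ↔ p.IsBlockOccurrence ℓ l c := by
  simp only [Pattern.IsBlockOccurrence, StrictMono, h.isLevel_left_iff (hc _),
    h.firstPos_left (hc _), h.secondPos_left (hc _), h.siblings_left_iff (hc _) (hc _),
    add_lt_add_iff_right, add_left_inj]

/-- All positions in `r` move by the same amount `l.length + 2`, which preserves their order and
adjacency. -/
theorem isBlockOccurrence_right_iff {p : Pattern} {ℓ : ℕ} {c : Fin p.len → ℕ}
    (hc : ∀ j, c j ∈ r) :
    p.IsBlockOccurrence ℓ (blockCons b l r) c ↔ p.IsBlockOccurrence ℓ r c := by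
  simp only [Pattern.IsBlockOccurrence, StrictMono, h.isLevel_right_iff (hc _),
    h.firstPos_right (hc _), h.secondPos_right (hc _), h.siblings_right_iff (hc _) (hc _),
    add_lt_add_iff_right, add_right_comm _ (l.length + 2) 1, add_left_inj]

theorem isBlockOccurrence_add_two_iff {p : Pattern} {ℓ : ℕ} {c : Fin p.len → ℕ} :
    p.IsBlockOccurrence (ℓ + 2) (blockCons b l r) c ↔
      p.IsBlockOccurrence (ℓ + 1) l c ∨ p.IsBlockOccurrence (ℓ + 2) r c := by
  constructor
  · intro ho
    have hm : ∀ j, c j ∈ l ∨ c j ∈ r := fun j =>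
      (h.isLevel_add_two_iff.1 (ho.2.1 j)).imp IsLevel.mem IsLevel.mem
    have hs := ho.2.2.2.1
    -- The pattern is nonempty, so its first block picks a side; siblings of that block cannot lie
    -- on the other side.
    rcases hm ⟨0, ho.1⟩ with h0 | h0
    · exact .inl ((h.isBlockOccurrence_left_iff fun j =>
        (hm j).resolve_right fun hj => h.not_siblings h0 hj (hs _ _)).1 ho)
    · exact .inr ((h.isBlockOccurrence_right_iff fun j =>
        (hm j).resolve_left fun hj => h.not_siblings hj h0 (hs _ _)).1 ho)
  · rintro (ho | ho)
    · exact (h.isBlockOccurrence_left_iff fun j => (ho.2.1 j).mem).2 ho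
    · exact (h.isBlockOccurrence_right_iff fun j => (ho.2.1 j).mem).2 ho

/-- The convention that the empty pattern never occurs is needed here: the empty choice of blocks
would otherwise belong to both sets of the union. -/
theorem blockCount_add_two (p : Pattern) (ℓ : ℕ) :
    p.blockCount (ℓ + 2) (blockCons b l r) =
      p.blockCount (ℓ + 1) l + p.blockCount (ℓ + 2) r := by
  rw [Pattern.blockCount, Pattern.blockCount, Pattern.blockCount,
    ← Set.ncard_union_eq _ (finite_setOf_isBlockOccurrence ..)
      (finite_setOf_isBlockOccurrence ..)]
  · congr 1
    ext c
    exact h.isBlockOccurrence_add_two_iff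
  · rw [Set.disjoint_left]
    intro c hl hr
    exact h.disjoint (hl.2.1 ⟨0, hl.1⟩).mem (hr.2.1 ⟨0, hl.1⟩).mem

theorem bl_add_two (ℓ : ℕ) : bl (ℓ + 2) (blockCons b l r) = bl (ℓ + 1) l + bl (ℓ + 2) r := by
  rw [bl, bl, bl, ← Set.ncard_union_eq _ (finite_setOf_isLevel ..) (finite_setOf_isLevel ..)]
  · congr 1
    ext c
    exact h.isLevel_add_two_iff
  · rw [Set.disjoint_left]
    intro c hl hr
    exact h.disjoint hl.mem hr.mem

theorem bl_one : bl 1 (blockCons b l r) = bl 1 r + 1 := by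
  have : {i | IsLevel (blockCons b l r) 1 i} = insert b {i | IsLevel r 1 i} := by
    ext i
    exact h.isLevel_one_iff
  rw [bl, this, Set.ncard_insert_of_notMem (fun hb => h.notMem_right hb.mem)
    (finite_setOf_isLevel r 1), bl]

end IsSplit

/-! ### Vanishing on the empty word and at high levels -/

theorem bl_nil (ℓ : ℕ) : bl ℓ [] = 0 := by
  rw [bl, Set.ncard_eq_zero (finite_setOf_isLevel _ _), Set.eq_empty_iff_forall_notMem]
  exact fun i hi => List.not_mem_nil hi.mem

theorem blockCount_nil (p : Pattern) (ℓ : ℕ) : p.blockCount ℓ [] = 0 := by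
  rw [Pattern.blockCount, Set.ncard_eq_zero (finite_setOf_isBlockOccurrence ..),
    Set.eq_empty_iff_forall_notMem]
  exact fun c hc => List.not_mem_nil (hc.2.1 ⟨0, hc.1⟩).mem

/-- A crude bound, enough to turn the infinite product over levels into a finite one. -/
theorem IsNested.level_le_length {w : List ℕ} (hw : IsNested w) {ℓ i : ℕ} (h : IsLevel w ℓ i) :
    ℓ ≤ w.length := by
  induction hw generalizing ℓ i with
  | nil => exact absurd h.mem List.not_mem_nil
  | blockCons hl hr hbr hlr hlt ihl ihr =>
    simp only [List.length_cons, List.length_append]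
    match ℓ, h with
    | 1, _ => omega
    | ℓ + 2, h =>
      rcases (IsSplit.mk hl hr hbr hlr hlt).isLevel_add_two_iff.1 h with h | h
      · have := ihl h
        omega
      · have := ihr h
        omega

theorem IsNested.bl_eq_zero {w : List ℕ} (hw : IsNested w) {ℓ : ℕ} (h : w.length < ℓ) :
    bl ℓ w = 0 := by
  rw [bl, Set.ncard_eq_zero (finite_setOf_isLevel _ _), Set.eq_empty_iff_forall_notMem]
  exact fun i hi => (hw.level_le_length hi).not_gt h

theorem IsNested.blockCount_eq_zero {w : List ℕ} (hw : IsNested w) (p : Pattern) {ℓ : ℕ}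
    (h : w.length < ℓ) : p.blockCount ℓ w = 0 := by
  rw [Pattern.blockCount, Set.ncard_eq_zero (finite_setOf_isBlockOccurrence ..),
    Set.eq_empty_iff_forall_notMem]
  exact fun c hc => (hw.level_le_length (hc.2.1 ⟨0, hc.1⟩)).not_gt h

/-! ### The word of level `1` letters -/

/-- The letters of the level `1` blocks of a Stirling word, from left to right. -/
def tops : List ℕ → List ℕ
  | [] => []
  | b :: w => b :: tops ((w.dropWhile (· != b)).tail)
termination_by w => w.length
decreasing_by
  simp only [List.length_cons, List.length_tail]
  have := (List.dropWhile_sublist (l := w) (· != b)).length_le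
  omega

theorem tops_nil : tops [] = [] := by rw [tops]

theorem tops_blockCons {b : ℕ} {l r : List ℕ} (h : b ∉ l) :
    tops (blockCons b l r) = b :: tops r := by
  rw [blockCons, tops, List.dropWhile_append_of_pos, List.dropWhile_cons_of_neg (by simp),
    List.tail_cons]
  intro a ha
  simp only [bne_iff_ne]
  rintro rfl
  exact h ha

theorem IsNested.mem_tops {w : List ℕ} (hw : IsNested w) {i : ℕ} :
    i ∈ tops w ↔ IsLevel w 1 i := by
  induction hw with
  | nil =>
    rw [tops_nil]
    exact iff_of_false List.not_mem_nil fun h => List.not_mem_nil h.mem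
  | blockCons hl hr hbr hlr hlt ihl ihr =>
    have h := IsSplit.mk hl hr hbr hlr hlt
    rw [tops_blockCons h.notMem_left, h.isLevel_one_iff, List.mem_cons, ihr]

theorem IsNested.mem_of_mem_tops {w : List ℕ} (hw : IsNested w) {i : ℕ} (hi : i ∈ tops w) :
    i ∈ w :=
  (hw.mem_tops.1 hi).mem

theorem IsNested.pairwise_firstPos_tops {w : List ℕ} (hw : IsNested w) :
    (tops w).Pairwise fun i j => firstPos w i < firstPos w j := by
  induction hw with
  | nil => simp [tops_nil]
  | blockCons hl hr hbr hlr hlt ihl ihr =>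
    have h := IsSplit.mk hl hr hbr hlr hlt
    rw [tops_blockCons h.notMem_left, List.pairwise_cons]
    refine ⟨fun j hj => ?_, ihr.imp_of_mem fun hi hj hij => ?_⟩
    · rw [IsSplit.firstPos_self, h.firstPos_right (hr.mem_of_mem_tops hj)]
      omega
    · rwa [h.firstPos_right (hr.mem_of_mem_tops hi), h.firstPos_right (hr.mem_of_mem_tops hj),
        add_lt_add_iff_right]

theorem IsNested.firstPos_tops_eq_zero_iff {w : List ℕ} (hw : IsNested w) {k : ℕ}
    (hk : k < (tops w).length) : firstPos w (tops w)[k] = 0 ↔ k = 0 := by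
  cases hw with
  | nil => simp [tops_nil] at hk
  | @blockCons b l r hl hr hbr hlr hlt =>
    have h := IsSplit.mk hl hr hbr hlr hlt
    have ht := tops_blockCons (r := r) h.notMem_left
    rcases k with _ | k
    · simp [ht, firstPos]
    · have hk' : k < (tops r).length := by simpa [ht] using hk
      have : (tops (BlockPattern.blockCons b l r))[k + 1] = (tops r)[k] := by simp [ht]
      rw [this, h.firstPos_right (hr.mem_of_mem_tops (List.getElem_mem _))]
      omega

/-- Level 1 blocks tile the word without gaps, so contiguous blocks are exactly consecutive entries
of `tops w`. This translates underlines of block patterns into underlines of ordinary ones. -/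
theorem IsNested.firstPos_tops_eq_iff {w : List ℕ} (hw : IsNested w) {j k : ℕ}
    (hj : j < (tops w).length) (hk : k < (tops w).length) :
    firstPos w (tops w)[k] = secondPos w (tops w)[j] + 1 ↔ k = j + 1 := by
  induction hw generalizing j k with
  | nil => simp [tops_nil] at hk
  | @blockCons b l r hl hr hbr hlr hlt ihl ihr =>
    have h := IsSplit.mk hl hr hbr hlr hlt
    have ht := tops_blockCons (r := r) h.notMem_left
    have ht0 : ∀ h0, (tops (BlockPattern.blockCons b l r))[0]'h0 = b := by simp [ht]
    have hts : ∀ i hi, ∃ hi', (tops (BlockPattern.blockCons b l r))[i + 1]'hi = (tops r)[i]'hi' :=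
      fun i hi => ⟨by simpa [ht] using hi, by simp [ht]⟩
    rcases k with _ | k
    · rw [ht0, IsSplit.firstPos_self]
      omega
    · obtain ⟨hk', hk''⟩ := hts k hk
      rw [hk'', h.firstPos_right (hr.mem_of_mem_tops (List.getElem_mem _))]
      rcases j with _ | j
      · rw [ht0, h.secondPos_self]
        -- The block of `b` ends just before `r`, so the next block is the one starting at position
        -- 0 of `r`.
        have := hr.firstPos_tops_eq_zero_iff hk'
        omega
      · obtain ⟨hj', hj''⟩ := hts j hj
        rw [hj'', h.secondPos_right (hr.mem_of_mem_tops (List.getElem_mem _))]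
        have := ihr hj' hk'
        omega

/-- The number of occurrences of `p` in the word `s`. -/
def Pattern.listCount (p : Pattern) (s : List ℕ) : ℕ :=
  {i : Fin p.len → Fin s.length | p.IsOccurrence s.get i}.ncard

theorem IsNested.firstPos_tops_lt_iff {w : List ℕ} (hw : IsNested w) {j k : Fin (tops w).length} :
    firstPos w ((tops w).get j) < firstPos w ((tops w).get k) ↔ j < k := by
  have : StrictMono fun j => firstPos w ((tops w).get j) :=
    fun j k hjk => List.pairwise_iff_get.1 hw.pairwise_firstPos_tops j k hjk
  exact this.lt_iff_lt

theorem IsNested.nodup_tops {w : List ℕ} (hw : IsNested w) : (tops w).Nodup :=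
  hw.pairwise_firstPos_tops.imp fun h => by rintro rfl; exact lt_irrefl _ h

theorem IsNested.isBlockOccurrence_one_iff {w : List ℕ} (hw : IsNested w) (p : Pattern)
    (i : Fin p.len → Fin (tops w).length) :
    p.IsBlockOccurrence 1 w (fun j => (tops w).get (i j)) ↔ p.IsOccurrence (tops w).get i := by
  have hmem : ∀ j, IsLevel w 1 ((tops w).get j) := fun j => hw.mem_tops.1 (List.get_mem _ _)
  have hs : ∀ j k, Siblings w ((tops w).get j) ((tops w).get k) := fun j k =>
    .inl ⟨hmem j, hmem k⟩
  have hadj : ∀ j k : Fin (tops w).length, firstPos w ((tops w).get k) =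
      secondPos w ((tops w).get j) + 1 ↔ (k : ℕ) = j + 1 := fun j k =>
    hw.firstPos_tops_eq_iff j.2 k.2
  simp only [Pattern.IsBlockOccurrence, Pattern.IsOccurrence, StrictMono, hw.firstPos_tops_lt_iff,
    hmem, hs, hadj, implies_true, true_and]

/-- At level 1 all blocks are siblings, and the entries of `tops w` are distinct, so choosing blocks
is the same as choosing positions in `tops w`. -/
theorem IsNested.blockCount_one {w : List ℕ} (hw : IsNested w) (p : Pattern) :
    p.blockCount 1 w = p.listCount (tops w) := by
  have hinj : Function.Injective
      fun (i : Fin p.len → Fin (tops w).length) j => (tops w).get (i j) :=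
    (List.nodup_iff_injective_get.1 hw.nodup_tops).comp_left
  rw [Pattern.blockCount, Pattern.listCount, ← Set.ncard_image_of_injective _ hinj]
  congr 1
  ext c
  constructor
  · intro hc
    have : ∀ j, ∃ i, (tops w).get i = c j := fun j =>
      List.mem_iff_get.1 (hw.mem_tops.2 (hc.2.1 j))
    choose i hi using this
    obtain rfl : (fun j => (tops w).get (i j)) = c := funext hi
    exact ⟨i, (hw.isBlockOccurrence_one_iff p i).1 hc, rfl⟩
  · rintro ⟨i, hi, rfl⟩
    exact (hw.isBlockOccurrence_one_iff p i).2 hi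

/-! ### Weights of words -/

variable {R : Type*} [CommRing R]

/-- The contribution of the level `i + 1` blocks to the weight of `w`. -/
def levelWeight (p : ℕ → Pattern) (x y : ℕ → R) (w : List ℕ) (i : ℕ) : R :=
  x i ^ (p i).blockCount (i + 1) w * y i ^ bl (i + 1) w

open Classical in
/-- The weight of `w` in `g_n^{A,p}(x; y)`, which is `0` when `w` contains a forbidden pattern. -/
def weight (A : ℕ → Set Pattern) (p : ℕ → Pattern) (x y : ℕ → R) (w : List ℕ) : R :=
  if ∀ i, ∀ a ∈ A i, a.blockCount (i + 1) w = 0 then ∏ᶠ i, levelWeight p x y w i else 0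

open Classical in
/-- The weight of `w` without the contribution of the patterns at level `1`. -/
def deepWeight (A : ℕ → Set Pattern) (p : ℕ → Pattern) (x y : ℕ → R) (w : List ℕ) : R :=
  if ∀ i, ∀ a ∈ A (i + 1), a.blockCount (i + 2) w = 0 then
    y 0 ^ bl 1 w * ∏ᶠ i, levelWeight p x y w (i + 1) else 0

open Classical in
/-- The contribution of the patterns at level `1` to the weight of a Stirling word whose level `1`
letters form the word `s`. -/
def topWeight (A : Set Pattern) (p : Pattern) (z : R) (s : List ℕ) : R :=
  if ∀ a ∈ A, a.listCount s = 0 then z ^ p.listCount s else 0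

theorem g_eq_sum_weight [Algebra ℚ R] (A : ℕ → Set Pattern) (p : ℕ → Pattern) (n : ℕ)
    (x y : ℕ → R) : g A p n x y = ∑ w ∈ stirlingOn (Finset.Icc 1 n), weight A p x y w := by
  rw [g, stirlingAvoid, Finset.sum_filter]
  rfl

theorem IsNested.levelWeight_eq_one {w : List ℕ} (hw : IsNested w) (p : ℕ → Pattern)
    (x y : ℕ → R) {i : ℕ} (hi : w.length ≤ i) : levelWeight p x y w i = 1 := by
  rw [levelWeight, hw.blockCount_eq_zero _ (by omega), hw.bl_eq_zero (by omega), pow_zero,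
    pow_zero, one_mul]

theorem finprod_eq_prod_range {u : ℕ → R} {N : ℕ} (h : ∀ i, N ≤ i → u i = 1) :
    ∏ᶠ i, u i = ∏ i ∈ Finset.range N, u i := by
  refine finprod_eq_prod_of_mulSupport_subset _ fun i hi => ?_
  by_contra hN
  exact hi (h i (by simpa using hN))

theorem weight_eq_mul {w : List ℕ} (hw : IsNested w) (A : ℕ → Set Pattern) (p : ℕ → Pattern)
    (x y : ℕ → R) :
    weight A p x y w = topWeight (A 0) (p 0) (x 0) (tops w) * deepWeight A p x y w := by
  have hprod : ∏ᶠ i, levelWeight p x y w i = levelWeight p x y w 0 *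
      ∏ᶠ i, levelWeight p x y w (i + 1) := by
    rw [finprod_eq_prod_range (N := w.length + 1)
        fun i hi => hw.levelWeight_eq_one p x y (by omega),
      finprod_eq_prod_range (N := w.length) fun i hi => hw.levelWeight_eq_one p x y (by omega),
      Finset.prod_range_succ', mul_comm]
  have hall : (∀ i, ∀ a ∈ A i, a.blockCount (i + 1) w = 0) ↔
      (∀ a ∈ A 0, a.listCount (tops w) = 0) ∧
        ∀ i, ∀ a ∈ A (i + 1), a.blockCount (i + 2) w = 0 := by
    simp only [← hw.blockCount_one]
    exact ⟨fun h => ⟨h 0, fun i => h (i + 1)⟩, fun h i => by cases i; exacts [h.1, h.2 _]⟩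
  rw [weight, topWeight, deepWeight, hprod, levelWeight, zero_add, hw.blockCount_one]
  by_cases h₁ : ∀ a ∈ A 0, a.listCount (tops w) = 0
  · by_cases h₂ : ∀ i, ∀ a ∈ A (i + 1), a.blockCount (i + 2) w = 0
    · rw [if_pos (hall.2 ⟨h₁, h₂⟩), if_pos h₁, if_pos h₂]
      ring
    · rw [if_neg fun h => h₂ (hall.1 h).2, if_neg h₂, mul_zero]
  · rw [if_neg fun h => h₁ (hall.1 h).1, if_neg h₁, zero_mul]

theorem deepWeight_nil (A : ℕ → Set Pattern) (p : ℕ → Pattern) (x y : ℕ → R) :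
    deepWeight A p x y [] = 1 := by
  simp [deepWeight, levelWeight, blockCount_nil, bl_nil]

/-- Each level 1 block contributes one `y 0` and the weight of its inner word for the shifted data.
Keeping the power of `y 0` in this factor is what produces `y 0 * g` as the coefficients of `H'`. -/
theorem deepWeight_blockCons {b : ℕ} {l r : List ℕ} (h : IsSplit b l r) (A : ℕ → Set Pattern)
    (p : ℕ → Pattern) (x y : ℕ → R) :
    deepWeight A p x y (blockCons b l r) =
      y 0 * weight (sh A) (sh p) (sh x) (sh y) l * deepWeight A p x y r := by
  have hprod : ∏ᶠ i, levelWeight p x y (blockCons b l r) (i + 1) =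
      (∏ᶠ i, levelWeight (sh p) (sh x) (sh y) l i) * ∏ᶠ i, levelWeight p x y r (i + 1) := by
    rw [finprod_eq_prod_range (N := l.length + r.length),
      finprod_eq_prod_range (N := l.length + r.length),
      finprod_eq_prod_range (N := l.length + r.length), ← Finset.prod_mul_distrib]
    · refine Finset.prod_congr rfl fun i _ => ?_
      simp only [levelWeight, sh, h.blockCount_add_two, h.bl_add_two, pow_add]
      ring
    · exact fun i hi => h.right.levelWeight_eq_one p x y (by omega)
    · exact fun i hi => h.left.levelWeight_eq_one _ _ _ (by omega)
    · intro i hi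
      simp only [levelWeight, h.blockCount_add_two, h.bl_add_two,
        h.left.blockCount_eq_zero _ (by omega : l.length < i + 1), h.left.bl_eq_zero
          (by omega : l.length < i + 1), h.right.blockCount_eq_zero _
          (by omega : r.length < i + 2), h.right.bl_eq_zero (by omega : r.length < i + 2)]
      simp
  have hall : (∀ i, ∀ a ∈ A (i + 1), a.blockCount (i + 2) (blockCons b l r) = 0) ↔
      (∀ i, ∀ a ∈ sh A i, a.blockCount (i + 1) l = 0) ∧
        ∀ i, ∀ a ∈ A (i + 1), a.blockCount (i + 2) r = 0 := by
    simp only [h.blockCount_add_two, Nat.add_eq_zero_iff, sh]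
    exact ⟨fun h => ⟨fun i a ha => (h i a ha).1, fun i a ha => (h i a ha).2⟩,
      fun h i a ha => ⟨h.1 i a ha, h.2 i a ha⟩⟩
  rw [deepWeight, deepWeight, weight, hprod, h.bl_one]
  by_cases h₁ : ∀ i, ∀ a ∈ sh A i, a.blockCount (i + 1) l = 0
  · by_cases h₂ : ∀ i, ∀ a ∈ A (i + 1), a.blockCount (i + 2) r = 0
    · rw [if_pos (hall.2 ⟨h₁, h₂⟩), if_pos h₁, if_pos h₂]
      ring
    · rw [if_neg fun h => h₂ (hall.1 h).2, if_neg h₂, mul_zero]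
  · rw [if_neg fun h => h₁ (hall.1 h).1, if_neg h₁, mul_zero, zero_mul]

/-! ### Orderings of a finite set -/

/-- The words that contain each letter of `M` exactly once. -/
def orderings (M : Finset ℕ) : Finset (List ℕ) :=
  (Multiset.lists M.val).toFinset

theorem mem_orderings_iff_coe {M : Finset ℕ} {s : List ℕ} : s ∈ orderings M ↔ M.val = s := by
  rw [orderings, Multiset.mem_toFinset, Multiset.mem_lists_iff]
  rfl

theorem mem_orderings {M : Finset ℕ} {s : List ℕ} :
    s ∈ orderings M ↔ s.Nodup ∧ s.toFinset = M := by
  rw [mem_orderings_iff_coe]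
  constructor
  · intro h
    have hs : s.Nodup := by
      rw [← Multiset.coe_nodup, ← h]
      exact M.nodup
    refine ⟨hs, Finset.val_injective ?_⟩
    rw [h, List.toFinset_val, hs.dedup]
  · rintro ⟨hs, rfl⟩
    rw [List.toFinset_val, hs.dedup]

theorem perm_toList_of_mem_orderings {M : Finset ℕ} {s : List ℕ} (h : s ∈ orderings M) :
    s.Perm M.toList := by
  rw [← Multiset.coe_eq_coe, Finset.coe_toList, mem_orderings_iff_coe.1 h]

/-- Occurrences depend only on the relative order of the entries. The lengths `m` and `n` are kept
separate because the length of a `List.ofFn` has to be rewritten. -/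
theorem Pattern.ncard_isOccurrence_congr (p : Pattern) {α β : Type*} [LT α] [LT β] {m n : ℕ}
    (h : m = n) {u : Fin m → α} {v : Fin n → β}
    (huv : ∀ j k, u j < u k ↔ v (j.cast h) < v (k.cast h)) :
    {i : Fin p.len → Fin m | p.IsOccurrence u i}.ncard =
      {i : Fin p.len → Fin n | p.IsOccurrence v i}.ncard := by
  subst h
  congr 1
  ext i
  simp only [Set.mem_ofPred_eq, IsOccurrence, OrderIso, huv]
  rfl

theorem Pattern.listCount_ofFn (p : Pattern) {n : ℕ} (π : Equiv.Perm (Fin n)) (e : Fin n ↪o ℕ) :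
    p.listCount (List.ofFn fun i => e (π i)) = p.count π :=
  p.ncard_isOccurrence_congr List.length_ofFn fun j k => by
    simp only [List.get_ofFn, e.lt_iff_lt]

theorem Pattern.listCount_nil (p : Pattern) : p.listCount [] = 0 := by
  rw [listCount, Set.ncard_eq_zero (Set.toFinite _), Set.eq_empty_iff_forall_notMem]
  exact fun i hi => (i ⟨0, hi.1⟩).elim0

theorem topWeight_nil (A : Set Pattern) (p : Pattern) (z : R) : topWeight A p z [] = 1 := by
  simp [topWeight, Pattern.listCount_nil]

/-- The increasing enumeration of `M` carries permutations to orderings of `M` and preserves all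
pattern counts. -/
theorem sum_topWeight [Algebra ℚ R] (A : Set Pattern) (p : Pattern) (z : R) (M : Finset ℕ) :
    ∑ s ∈ orderings M, topWeight A p z s = f A p M.card z := by
  rw [f, permAvoid, Finset.sum_filter]
  symm
  refine Finset.sum_bij (fun π _ => List.ofFn fun i => M.orderEmbOfFin rfl (π i)) ?_ ?_ ?_ ?_
  · intro π _
    rw [mem_orderings]
    refine ⟨List.nodup_ofFn.2 ((M.orderEmbOfFin rfl).injective.comp π.injective), ?_⟩
    ext x
    rw [List.mem_toFinset, List.mem_ofFn, ← Finset.mem_coe, ← Finset.range_orderEmbOfFin M rfl]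
    exact (π.surjective.exists (p := fun k => M.orderEmbOfFin rfl k = x)).symm
  · intro π _ π' _ h
    ext i
    exact congrArg _ ((M.orderEmbOfFin rfl).injective (congrFun (List.ofFn_injective h) i))
  · intro s hs
    obtain ⟨hnd, rfl⟩ := mem_orderings.1 hs
    have hlen : s.toFinset.card = s.length := List.toFinset_card_of_nodup hnd
    -- The permutation behind `s` sends `i` to the rank of the `i`-th letter of `s`.
    have hex : ∀ i : Fin s.toFinset.card,
        ∃ k, s.toFinset.orderEmbOfFin rfl k = s.get (i.cast hlen) := by
      intro i
      have : s.get (i.cast hlen) ∈ Set.range (s.toFinset.orderEmbOfFin rfl) := by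
        rw [Finset.range_orderEmbOfFin]
        simp
      exact this
    choose π hπ using hex
    have hinj : Function.Injective π := by
      intro i j hij
      have := (hπ i).symm.trans (hij ▸ hπ j)
      exact Fin.cast_injective hlen (List.nodup_iff_injective_get.1 hnd this)
    refine ⟨Equiv.ofBijective π (Finite.injective_iff_bijective.1 hinj), Finset.mem_univ _, ?_⟩
    refine List.ext_get (by simp [hlen]) fun n h₁ h₂ => ?_
    rw [List.get_ofFn]
    exact hπ _
  · intro π _
    have h : ∀ q : Pattern, q.count π = _ := fun q =>
      (q.listCount_ofFn π (M.orderEmbOfFin rfl)).symm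
    classical exact if_congr (forall₂_congr fun a _ => by rw [h a]) (by rw [h p]) rfl

theorem f_zero [Algebra ℚ R] (A : Set Pattern) (p : Pattern) (z : R) : f A p 0 z = 1 := by
  have h : orderings ∅ = {[]} := by
    ext s
    rw [mem_orderings, List.toFinset_eq_empty_iff, Finset.mem_singleton]
    exact ⟨fun h => h.2, by rintro rfl; exact ⟨List.nodup_nil, rfl⟩⟩
  rw [← Finset.card_empty (α := ℕ), ← sum_topWeight, h, Finset.sum_singleton, topWeight_nil]

/-! ### Words with prescribed level `1` letters -/

/-- The sum of `∏ h(|T_b|)` over the ways to distribute the elements of `S` that are not in `s`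
into sets `T_b`, for `b` in `s`, such that all elements of `T_b` are greater than `b`. -/
def fillSum (h : ℕ → R) : List ℕ → Finset ℕ → R
  | [], S => if S = ∅ then 1 else 0
  | b :: s, S => ∑ T ∈ S.powerset,
      if b ∈ S ∧ ∀ x ∈ T, b < x then h T.card * fillSum h s (S.erase b \ T) else 0

/-- Both orders unfold to one sum over pairs of sets `T`, `U` attached to `a`, `b`, under conditions
symmetric in the two letters. -/
theorem fillSum_swap (h : ℕ → R) (a b : ℕ) (s : List ℕ) (S : Finset ℕ) :
    fillSum h (a :: b :: s) S = fillSum h (b :: a :: s) S := by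
  -- Letting both sets range over all subsets of `S` makes the conditions hidden in the successive
  -- removals explicit, so that the symmetry becomes visible.
  have key : ∀ a b, fillSum h (a :: b :: s) S = ∑ T ∈ S.powerset, ∑ U ∈ S.powerset,
      if (a ∈ S ∧ b ∈ S ∧ a ≠ b ∧ Disjoint T U ∧ a ∉ U ∧ b ∉ T) ∧
        (∀ x ∈ T, a < x) ∧ ∀ x ∈ U, b < x then
        h T.card * h U.card * fillSum h s ((S \ {a, b}) \ (T ∪ U)) else 0 := by
    intro a b
    rw [fillSum]
    refine Finset.sum_congr rfl fun T hT => ?_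
    by_cases hc : a ∈ S ∧ ∀ x ∈ T, a < x
    · rw [if_pos hc, fillSum, Finset.mul_sum]
      have hsub : (S.erase a \ T).powerset ⊆ S.powerset :=
        Finset.powerset_mono.2 (Finset.sdiff_subset.trans (Finset.erase_subset _ _))
      refine Finset.sum_subset_zero_on_sdiff hsub ?_ ?_
      · intro U hU
        rw [Finset.mem_sdiff, Finset.mem_powerset, Finset.mem_powerset] at hU
        refine if_neg fun hcon => hU.2 fun x hx => ?_
        rw [Finset.mem_sdiff, Finset.mem_erase]
        refine ⟨⟨?_, hU.1 hx⟩, fun hxT => Finset.disjoint_left.1 hcon.1.2.2.2.1 hxT hx⟩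
        rintro rfl
        exact hcon.1.2.2.2.2.1 hx
      · intro U hU
        rw [Finset.mem_powerset] at hU
        have hd : Disjoint T U :=
          Finset.disjoint_left.2 fun x hxT hxU => (Finset.mem_sdiff.1 (hU hxU)).2 hxT
        have haU : a ∉ U := fun haU => by simpa using hU haU
        have hset : (S.erase a \ T).erase b \ U = (S \ {a, b}) \ (T ∪ U) := by
          ext x
          simp only [Finset.mem_sdiff, Finset.mem_erase, Finset.mem_insert, Finset.mem_singleton,
            Finset.mem_union]
          tauto
        have hiff : (b ∈ S.erase a \ T ∧ ∀ x ∈ U, b < x) ↔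
            (a ∈ S ∧ b ∈ S ∧ a ≠ b ∧ Disjoint T U ∧ a ∉ U ∧ b ∉ T) ∧
              (∀ x ∈ T, a < x) ∧ ∀ x ∈ U, b < x := by
          simp only [Finset.mem_sdiff, Finset.mem_erase, hd, haU, hc.1, not_false_eq_true]
          have := hc.2
          have : b ≠ a ↔ a ≠ b := ne_comm
          tauto
        rw [hset, if_congr hiff rfl rfl, mul_ite, mul_zero, mul_assoc]
    · rw [if_neg hc]
      exact (Finset.sum_eq_zero fun U _ => if_neg fun hcon => hc ⟨hcon.1.1, hcon.2.1⟩).symm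
  rw [key, key, Finset.sum_comm]
  refine Finset.sum_congr rfl fun T _ => Finset.sum_congr rfl fun U _ => ?_
  rw [Finset.pair_comm, Finset.union_comm, mul_comm (h U.card)]
  refine if_congr ?_ rfl rfl
  rw [disjoint_comm, ne_comm]
  tauto

theorem fillSum_perm (h : ℕ → R) {s s' : List ℕ} (hs : s.Perm s') (S : Finset ℕ) :
    fillSum h s S = fillSum h s' S := by
  induction hs generalizing S with
  | nil => rfl
  | cons a _ ih => simp only [fillSum, ih]
  | swap a b s => exact fillSum_swap h b a s S
  | trans _ _ ih₁ ih₂ => exact (ih₁ S).trans (ih₂ S)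

/-- In `sum_fillSum`, the first conclusion discards sets `M` that meet the letters already removed,
and the second discards those without the minimum of `S`. -/
theorem fillSum_ne_zero (h : ℕ → R) {s : List ℕ} {S : Finset ℕ} (hs : fillSum h s S ≠ 0) :
    (∀ b ∈ s, b ∈ S) ∧ ∀ x ∈ S, ∃ b ∈ s, b ≤ x := by
  induction s generalizing S with
  | nil =>
    have : S = ∅ := by
      by_contra hS
      exact hs (if_neg hS)
    simp [this]
  | cons b s ih =>
    obtain ⟨T, hT, hne⟩ := Finset.exists_ne_zero_of_sum_ne_zero hs
    by_cases hc : b ∈ S ∧ ∀ x ∈ T, b < x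
    · rw [if_pos hc] at hne
      obtain ⟨h₁, h₂⟩ := ih (right_ne_zero_of_mul hne)
      constructor
      · rintro a (_ | ⟨_, ha⟩)
        · exact hc.1
        · exact Finset.mem_of_mem_erase (Finset.mem_sdiff.1 (h₁ a ha)).1
      · intro x hx
        by_cases hxb : x = b
        · exact ⟨b, List.mem_cons_self, hxb.ge⟩
        by_cases hxT : x ∈ T
        · exact ⟨b, List.mem_cons_self, (hc.2 x hxT).le⟩
        · obtain ⟨a, ha, hax⟩ := h₂ x (by simp [hx, hxb, hxT])
          exact ⟨a, List.mem_cons_of_mem _ ha, hax⟩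
    · exact absurd (if_neg hc) hne

/-- The coefficients of `H ^ m / m!`, when `h` are the coefficients of the derivative of `H` and
`H(0) = 0`, as exponential generating functions. -/
def divPowCoeff (h : ℕ → R) : ℕ → ℕ → R
  | 0, n => if n = 0 then 1 else 0
  | _ + 1, 0 => 0
  | m + 1, n + 1 => ∑ j ∈ Finset.range (n + 1), n.choose j * (h j * divPowCoeff h m (n - j))

/-- The minimum `a` of `S` lies in no `T_b`, so it belongs to `M`. Its own set `T_a` is an arbitrary
subset of the other letters, and a choice of its size `j` gives the binomial recurrence of
`divPowCoeff`. -/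
theorem sum_fillSum (h : ℕ → R) (m : ℕ) (S : Finset ℕ) :
    ∑ M ∈ S.powersetCard m, fillSum h M.toList S = divPowCoeff h m S.card := by
  induction m generalizing S with
  | zero => simp [fillSum, divPowCoeff]
  | succ m ih =>
    rcases S.eq_empty_or_nonempty with rfl | hS
    · rw [Finset.powersetCard_eq_empty.2 (by simp), Finset.sum_empty, Finset.card_empty,
        divPowCoeff]
    set a := S.min' hS with ha
    have haS : a ∈ S := S.min'_mem hS
    have hlt : ∀ x ∈ S.erase a, a < x := fun x hx =>
      S.min'_lt_of_mem_erase_min' hS hx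
    have hsplit : S.powersetCard (m + 1) = (S.erase a).powersetCard (m + 1) ∪
        ((S.erase a).powersetCard m).image (insert a) := by
      rw [← Finset.powersetCard_succ_insert (Finset.notMem_erase a S), Finset.insert_erase haS]
    have hnot : ∀ k, ∀ M ∈ (S.erase a).powersetCard k, a ∉ M := fun k M hM haM =>
      Finset.notMem_erase a S ((Finset.mem_powersetCard.1 hM).1 haM)
    rw [hsplit, Finset.sum_union, Finset.sum_eq_zero, zero_add, Finset.sum_image]
    · have hcard : S.card = (S.erase a).card + 1 := (Finset.card_erase_add_one haS).symm
      have hstep : ∀ M ∈ (S.erase a).powersetCard m, fillSum h (insert a M).toList S =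
          ∑ T ∈ (S.erase a).powerset, h T.card * fillSum h M.toList (S.erase a \ T) := by
        intro M hM
        -- Symmetry allows `a` to be treated first, wherever it stands in the list.
        rw [fillSum_perm h (Finset.toList_insert (hnot m M hM)), fillSum]
        symm
        refine Finset.sum_subset_zero_on_sdiff (Finset.powerset_mono.2 (Finset.erase_subset a S))
          ?_ ?_
        · intro T hT
          rw [Finset.mem_sdiff, Finset.mem_powerset, Finset.mem_powerset] at hT
          refine if_neg fun hcon => hT.2 fun x hx => ?_
          exact Finset.mem_erase.2 ⟨(hcon.2 x hx).ne', hT.1 hx⟩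
        · intro T hT
          rw [if_pos ⟨haS, fun x hx => hlt x (Finset.mem_powerset.1 hT hx)⟩]
      rw [Finset.sum_congr rfl hstep, Finset.sum_comm, hcard, divPowCoeff]
      have hinner : ∀ T ∈ (S.erase a).powerset, ∑ M ∈ (S.erase a).powersetCard m,
          h T.card * fillSum h M.toList (S.erase a \ T) =
          h T.card * divPowCoeff h m ((S.erase a).card - T.card) := by
        intro T hT
        rw [← Finset.mul_sum, ← Finset.card_sdiff_of_subset (Finset.mem_powerset.1 hT), ← ih]
        congr 1
        symm
        refine Finset.sum_subset (Finset.powersetCard_mono Finset.sdiff_subset) ?_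
        intro M hM hM'
        by_contra hne
        refine hM' (Finset.mem_powersetCard.2 ⟨fun x hx => ?_, (Finset.mem_powersetCard.1 hM).2⟩)
        exact (fillSum_ne_zero h hne).1 x (Finset.mem_toList.2 hx)
      rw [Finset.sum_congr rfl hinner, Finset.sum_powerset_apply_card
        fun j => h j * divPowCoeff h m ((S.erase a).card - j)]
      simp only [nsmul_eq_mul]
    · intro M hM M' hM' heq
      have := congrArg (Finset.erase · a) heq
      simpa [Finset.erase_insert (hnot m M hM), Finset.erase_insert (hnot m M' hM')] using this
    · intro M hM
      by_contra hne
      obtain ⟨b, hb, hba⟩ := (fillSum_ne_zero h hne).2 a haS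
      have hbS := (Finset.mem_powersetCard.1 hM).1 (Finset.mem_toList.1 hb)
      exact (hlt b hbS).not_ge hba
    · rw [Finset.disjoint_left]
      intro M hM hM'
      obtain ⟨M', -, rfl⟩ := Finset.mem_image.1 hM'
      exact hnot _ _ hM (Finset.mem_insert_self a M')

/-! ### Summing weights over words grouped by their level 1 letters -/

theorem isSplit_of_mem {b : ℕ} {S T : Finset ℕ} {l r : List ℕ} (hT : ∀ x ∈ T, b < x)
    (hl : l ∈ stirlingOn T) (hr : r ∈ stirlingOn (S.erase b \ T)) : IsSplit b l r := by
  obtain ⟨hl', rfl⟩ := mem_stirlingOn.1 hl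
  obtain ⟨hr', hrS⟩ := mem_stirlingOn.1 hr
  have hmem : ∀ x ∈ r, x ≠ b ∧ x ∉ l := by
    intro x hx
    rw [← List.mem_toFinset, hrS] at hx
    simp at hx
    tauto
  exact ⟨hl', hr', fun hb => (hmem b hb).1 rfl, fun x hxl hxr => (hmem x hxr).2 hxl,
    by simpa using hT⟩

/-- Splitting off the first block reproduces the recursion of `fillSum`. The bound `N` restricts
`hc` to sets smaller than `N`, which suffices since an inner word omits its enclosing letter; this
is the form in which the later induction can supply `hc`. -/
theorem sum_deepWeight (A : ℕ → Set Pattern) (p : ℕ → Pattern) (x y : ℕ → R) (c : ℕ → R) {N : ℕ}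
    (hc : ∀ T : Finset ℕ, T.card < N →
      ∑ w ∈ stirlingOn T, weight (sh A) (sh p) (sh x) (sh y) w = c T.card)
    (s : List ℕ) {S : Finset ℕ} (hS : S.card ≤ N) :
    ∑ w ∈ stirlingOn S with tops w = s, deepWeight A p x y w =
      fillSum (fun j => y 0 * c j) s S := by
  induction s generalizing S with
  | nil =>
    rw [Finset.sum_filter]
    rcases S.eq_empty_or_nonempty with rfl | hne
    · simp [stirlingOn_empty, tops_nil, deepWeight_nil, fillSum]
    · rw [sum_stirlingOn hne, fillSum, if_neg hne.ne_empty]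
      refine Finset.sum_eq_zero fun b _ => Finset.sum_eq_zero fun T hT =>
        Finset.sum_eq_zero fun l hl => Finset.sum_eq_zero fun r hr => if_neg ?_
      rw [tops_blockCons (isSplit_of_mem (Finset.mem_filter.1 hT).2 hl hr).notMem_left]
      simp
  | cons a s ih =>
    rw [Finset.sum_filter]
    rcases S.eq_empty_or_nonempty with rfl | hne
    · simp [stirlingOn_empty, tops_nil, fillSum]
    rw [sum_stirlingOn hne]
    have hterm : ∀ b ∈ S, (∑ T ∈ S.powerset with ∀ x ∈ T, b < x, ∑ l ∈ stirlingOn T,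
        ∑ r ∈ stirlingOn (S.erase b \ T), if tops (blockCons b l r) = a :: s then
          deepWeight A p x y (blockCons b l r) else 0) =
        if b = a then ∑ T ∈ S.powerset with ∀ x ∈ T, a < x,
          y 0 * c T.card * fillSum (fun j => y 0 * c j) s (S.erase a \ T) else 0 := by
      intro b hb
      split_ifs with hba
      · subst hba
        refine Finset.sum_congr rfl fun T hT => ?_
        obtain ⟨hTS, hbT⟩ := Finset.mem_filter.1 hT
        rw [Finset.mem_powerset] at hTS
        have hTb : T ⊆ S.erase b := fun z hz => Finset.mem_erase.2 ⟨(hbT z hz).ne', hTS hz⟩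
        have hlt : (S.erase b).card < S.card := Finset.card_erase_lt_of_mem hb
        have hTN : T.card < N := (Finset.card_le_card hTb).trans_lt (hlt.trans_le hS)
        have hrN : (S.erase b \ T).card ≤ N :=
          (Finset.card_le_card Finset.sdiff_subset).trans (hlt.le.trans hS)
        rw [← hc T hTN, ← ih hrN, Finset.sum_filter, mul_assoc, Finset.sum_mul_sum,
          Finset.mul_sum]
        refine Finset.sum_congr rfl fun l hl => ?_
        rw [Finset.mul_sum]
        refine Finset.sum_congr rfl fun r hr => ?_
        have hsp := isSplit_of_mem hbT hl hr
        rw [tops_blockCons hsp.notMem_left, deepWeight_blockCons hsp, mul_ite, mul_zero,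
          mul_ite, mul_zero, mul_assoc]
        simp
      · refine Finset.sum_eq_zero fun T hT => Finset.sum_eq_zero fun l hl =>
          Finset.sum_eq_zero fun r hr => if_neg ?_
        rw [tops_blockCons (isSplit_of_mem (Finset.mem_filter.1 hT).2 hl hr).notMem_left]
        simp [hba]
    rw [Finset.sum_congr rfl hterm, Finset.sum_ite_eq', fillSum]
    split_ifs with haS
    · simp only [haS, true_and, Finset.sum_filter]
    · simp [haS]

theorem sum_weight_eq_of_card_lt [Algebra ℚ R] (A : ℕ → Set Pattern) (p : ℕ → Pattern)
    (x y : ℕ → R) (c : ℕ → R) (S : Finset ℕ)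
    (hc : ∀ T : Finset ℕ, T.card < S.card →
      ∑ w ∈ stirlingOn T, weight (sh A) (sh p) (sh x) (sh y) w = c T.card) :
    ∑ w ∈ stirlingOn S, weight A p x y w = ∑ m ∈ Finset.range (S.card + 1),
      f (A 0) (p 0) m (x 0) * divPowCoeff (fun j => y 0 * c j) m S.card := by
  have hmaps : ∀ w ∈ stirlingOn S, tops w ∈ S.powerset.biUnion orderings := by
    intro w hw
    obtain ⟨hw', rfl⟩ := mem_stirlingOn.1 hw
    rw [Finset.mem_biUnion]
    refine ⟨(tops w).toFinset, ?_, mem_orderings.2 ⟨hw'.nodup_tops, rfl⟩⟩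
    rw [Finset.mem_powerset]
    intro i hi
    rw [List.mem_toFinset] at hi ⊢
    exact hw'.mem_of_mem_tops hi
  rw [← Finset.sum_fiberwise_of_maps_to hmaps, Finset.sum_biUnion]
  · rw [Finset.sum_powerset]
    refine Finset.sum_congr rfl fun m _ => ?_
    rw [← sum_fillSum, Finset.mul_sum]
    refine Finset.sum_congr rfl fun M hM => ?_
    rw [← (Finset.mem_powersetCard.1 hM).2, ← sum_topWeight, Finset.sum_mul]
    refine Finset.sum_congr rfl fun s hs => ?_
    -- All orderings of `M` have the same filling sum, which thus factors out of the sum of the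
    -- `topWeight`s.
    rw [← fillSum_perm _ (perm_toList_of_mem_orderings hs),
      ← sum_deepWeight A p x y c hc s le_rfl, Finset.mul_sum]
    refine Finset.sum_congr rfl fun w hw => ?_
    obtain ⟨hwS, rfl⟩ := Finset.mem_filter.1 hw
    exact weight_eq_mul (mem_stirlingOn.1 hwS).1 A p x y
  · intro M _ M' _ hne
    refine Finset.disjoint_left.2 fun s hs hs' => hne ?_
    rw [← (mem_orderings.1 hs).2, ← (mem_orderings.1 hs').2]

theorem sum_weight_eq [Algebra ℚ R] (A : ℕ → Set Pattern) (p : ℕ → Pattern) (x y : ℕ → R)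
    (S : Finset ℕ) :
    ∑ w ∈ stirlingOn S, weight A p x y w = ∑ m ∈ Finset.range (S.card + 1),
      f (A 0) (p 0) m (x 0) *
        divPowCoeff (fun j => y 0 * g (sh A) (sh p) j (sh x) (sh y)) m S.card := by
  induction hn : S.card using Nat.strong_induction_on generalizing A p x y S with
  | _ n ih =>
  subst hn
  refine sum_weight_eq_of_card_lt A p x y _ S fun T hT => ?_
  -- The induction hypothesis, for the shifted data, evaluates the sums over `T` and over
  -- `Finset.Icc 1 T.card` to the same expression in `T.card`.
  rw [g_eq_sum_weight, ih _ hT _ _ _ _ T rfl,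
    ih _ hT _ _ _ _ (Finset.Icc 1 T.card) (by simp)]

theorem g_eq_sum [Algebra ℚ R] (A : ℕ → Set Pattern) (p : ℕ → Pattern) (n : ℕ) (x y : ℕ → R) :
    g A p n x y = ∑ m ∈ Finset.range (n + 1), f (A 0) (p 0) m (x 0) *
      divPowCoeff (fun j => y 0 * g (sh A) (sh p) j (sh x) (sh y)) m n := by
  simpa using (g_eq_sum_weight A p n x y).trans (sum_weight_eq A p x y (Finset.Icc 1 n))

theorem g_zero [Algebra ℚ R] (A : ℕ → Set Pattern) (p : ℕ → Pattern) (x y : ℕ → R) :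
    g A p 0 x y = 1 := by
  rw [g_eq_sum]
  simp [divPowCoeff, f_zero]

/-! ### The identity of power series -/

/-- Compare coefficients in `(H^(m+1))' = (m+1) * H^m * H'`. With the factorials multiplied out, no
division is needed. -/
theorem factorial_mul_coeff_pow (h : ℕ → R) (H : R⟦X⟧) (h₀ : coeff 0 H = 0)
    (hH : ∀ j, ((j + 1).factorial : R) * coeff (j + 1) H = h j) (m n : ℕ) :
    (n.factorial : R) * coeff n (H ^ m) = m.factorial * divPowCoeff h m n := by
  induction m generalizing n with
  | zero =>
    rw [pow_zero, coeff_one, divPowCoeff]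
    split_ifs with hn <;> simp [hn]
  | succ m ih =>
    rcases n with _ | n
    · rw [coeff_zero_eq_constantCoeff_apply] at h₀
      simp [divPowCoeff, h₀]
    · have hd := congrArg (coeff n) (PowerSeries.derivative_pow H (m + 1))
      rw [coeff_derivative, Nat.add_sub_cancel, mul_assoc, mul_comm (H ^ m),
        ← map_natCast (C (R := R)), coeff_C_mul, coeff_mul,
        Finset.Nat.sum_antidiagonal_eq_sum_range_succ
          (fun i j => coeff i (derivative R H) * coeff j (H ^ m))] at hd
      calc ((n + 1).factorial : R) * coeff (n + 1) (H ^ (m + 1))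
          = n.factorial * (coeff (n + 1) (H ^ (m + 1)) * (n + 1)) := by
            rw [Nat.factorial_succ]
            push_cast
            ring
        _ = (m + 1).factorial * divPowCoeff h (m + 1) (n + 1) := by
            rw [hd, divPowCoeff, Finset.mul_sum, Finset.mul_sum, Finset.mul_sum]
            refine Finset.sum_congr rfl fun j hj => ?_
            have hjn : j ≤ n := Nat.lt_succ_iff.1 (Finset.mem_range.1 hj)
            rw [coeff_derivative, ← hH, ← Nat.choose_mul_factorial_mul_factorial hjn]
            have := ih (n - j)
            push_cast [Nat.factorial_succ]
            linear_combination (m + 1 : R) * n.choose j * j.factorial * (j + 1) *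
              coeff (j + 1) H * this

theorem divPowCoeff_eq_zero (h : ℕ → R) {m n : ℕ} (hmn : n < m) : divPowCoeff h m n = 0 := by
  induction m generalizing n with
  | zero => omega
  | succ m ih =>
    rcases n with _ | n
    · rfl
    · rw [divPowCoeff]
      refine Finset.sum_eq_zero fun j _ => ?_
      rw [ih (by omega), mul_zero, mul_zero]

variable [Algebra ℚ R]

theorem algebraMap_one_div_mul_self {n : ℕ} (hn : n ≠ 0) :
    algebraMap ℚ R (1 / (n : ℚ)) * n = 1 := by
  rw [← map_natCast (algebraMap ℚ R), ← map_mul, one_div_mul_cancel (by exact_mod_cast hn),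
    map_one]

/-- The constant term that `egf` sets to 1 agrees with the general formula once `c 0 = 1`, which
`f_zero` and `g_zero` provide. -/
theorem coeff_egf (c : ℕ → R) (h₀ : c 0 = 1) (n : ℕ) :
    coeff n (egf c) = algebraMap ℚ R (1 / (n.factorial : ℚ)) * c n := by
  rw [egf, coeff_mk]
  split_ifs with hn
  · subst hn
    simp [h₀]
  · rfl

theorem G_eq_subst (A : ℕ → Set Pattern) (p : ℕ → Pattern) (x y : ℕ → R) :
    G A p x y = (F (A 0) (p 0) (x 0)).subst
      (C (y 0) * integral (G (sh A) (sh p) (sh x) (sh y)) : R⟦X⟧) := by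
  set H : R⟦X⟧ := C (y 0) * integral (G (sh A) (sh p) (sh x) (sh y)) with hHdef
  have h₀ : coeff 0 H = 0 := by
    rw [hHdef, coeff_C_mul, integral, coeff_mk, if_pos rfl, mul_zero]
  have hH : ∀ j, ((j + 1).factorial : R) * coeff (j + 1) H =
      y 0 * g (sh A) (sh p) j (sh x) (sh y) := by
    intro j
    rw [hHdef, coeff_C_mul, integral, coeff_mk, if_neg j.succ_ne_zero, Nat.add_sub_cancel, G,
      coeff_egf _ (g_zero _ _ _ _), Nat.factorial_succ, Nat.cast_mul]
    have h₁ := algebraMap_one_div_mul_self (R := R) j.succ_ne_zero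
    have h₂ := algebraMap_one_div_mul_self (R := R) j.factorial_ne_zero
    linear_combination y 0 * g (sh A) (sh p) j (sh x) (sh y) * (h₁ + h₂ *
      (algebraMap ℚ R (1 / ((j + 1 : ℕ) : ℚ)) * ((j + 1 : ℕ) : R)))
  ext n
  have hcoeff : ∀ d, coeff d (F (A 0) (p 0) (x 0)) • coeff n (H ^ d) =
      algebraMap ℚ R (1 / (n.factorial : ℚ)) * (f (A 0) (p 0) d (x 0) *
        divPowCoeff (fun j => y 0 * g (sh A) (sh p) j (sh x) (sh y)) d n) := by
    intro d
    rw [F, coeff_egf (fun m => f (A 0) (p 0) m (x 0)) (f_zero _ _ _), smul_eq_mul]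
    have h₁ := algebraMap_one_div_mul_self (R := R) n.factorial_ne_zero
    have h₂ := algebraMap_one_div_mul_self (R := R) d.factorial_ne_zero
    have h₃ := factorial_mul_coeff_pow _ H h₀ hH d n
    generalize algebraMap ℚ R (1 / (n.factorial : ℚ)) = u at *
    generalize algebraMap ℚ R (1 / (d.factorial : ℚ)) = v at *
    generalize f (A 0) (p 0) d (x 0) = a at *
    generalize divPowCoeff (R := R) _ d n = k at *
    linear_combination (-(v * a * (coeff n) (H ^ d))) * h₁ + u * v * a * h₃ + u * a * k * h₂
  rw [coeff_subst' (b := H) (hasSubst_C_mul_integral _ _)]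
  simp only [hcoeff]
  -- Since `H` has no constant term, only powers `d ≤ n` reach the coefficient of degree `n`.
  rw [finsum_eq_sum_of_support_subset (s := Finset.range (n + 1)), G,
    coeff_egf _ (g_zero _ _ _ _), g_eq_sum, Finset.mul_sum]
  intro d hd
  by_contra hn
  refine hd ?_
  have hnd : n < d := by simpa using hn
  simp only [divPowCoeff_eq_zero _ hnd, mul_zero]

end BlockPattern

end

theorem theorem1 {R : Type*} [CommRing R] [Algebra ℚ R]
    (A : ℕ → Set BlockPattern.Pattern) (p : ℕ → BlockPattern.Pattern) (x y : ℕ → R) :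
    BlockPattern.G A p x y =
      (BlockPattern.F (A 0) (p 0) (x 0)).subst
        (PowerSeries.C (y 0) *
          BlockPattern.integral
            (BlockPattern.G (BlockPattern.sh A) (BlockPattern.sh p)
              (BlockPattern.sh x) (BlockPattern.sh y)) : PowerSeries R) :=
  BlockPattern.G_eq_subst A p x y
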